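/- Let $K$ be a field of characteristic $p>0$, $n\ge 0$, $P_n=K[x_1,\dots,x_n]$, and let $\mathcal D=\mathcal D(P_n)\subseteq \mathrm{End}_K(P_n)$ be the ring of $K$-linear differential operators on $P_n$. Write $\partial^{[\beta]}=\prod_i \partial_i^{\beta_i}/\beta_i!$ for the divided power operators $x^\gamma\mapsto\prod_i\binom{\gamma_i}{\beta_i}x^{\gamma-\beta}$, and let $F_i=\bigoplus_{|\alpha|+|\beta|\le i}Kx^\alpha\partial^{[\beta]}$, $i\ge 0$, be the canonical filtration of $\mathcal D$. Modules are left modules. A finitely generated $\mathcal D$-module $M$ is called holonomic if there are a finite dimensional filtration $\{F_i'\}$ of the algebra $\mathcal D$ equivalent to $\{F_i\}$ (i.e. $F_i\subseteq F'_{ai+b}$ and $F'_i\subseteq F_{ci+d}$ for $i\gg0$, with natural numbers $a,b,c,d$, $a,c>0$), a finite dimensional subspace $M_0$ with $M=\mathcal D M_0$, and a polynomial $q\in\mathbb Q[t]$ of degree $n$ such that $\dim_K(F_i'M_0)\le q(i)$ for $i\gg 0$. A function $f:\mathbb N\to\mathbb N$ is an almost polynomial of degree $d$ with leading coefficient $c$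 if for some $k\ge1$ there are polynomials $q_s\in\mathbb Q[t]$, $s\in\mathbb Z/k\mathbb Z$, all of degree $d$ and with leading coefficient $c$, such that $f(i)=q_{i+k\mathbb Z}(i)$ for $i\gg0$; its multiplicity is $d!\,c$. A finitely presented module $M$ has dimension $d$ and multiplicity $e$ if $i\mapsto\dim_K(F_iM_0)$ is an almost polynomial of degree $d$ and multiplicity $e$ for a finite dimensional generating subspace $M_0$ of $M$ ($d$ and $e$ do not depend on $M_0$). 1. Let $M$ be a nonzero holonomic finitely presented $\mathcal D$-module. Then its multiplicity is a (positive) natural number: there is an integer $e\geq 1$ such that for every finite dimensional generating subspace $M_0$ of $M$ the function $i\mapsto\dim_K(F_iM_0)$ is an almost polynomial of degree $n$ and multiplicity $e$. 2. By contrast, for every natural number $d$ with $n<d\le 2n$ and every $\varepsilon>0$ there is a finitely presented non-holonomic $\mathcal D$-module of dimension $d$ and multiplicity $e$ with $0<e<\varepsilon$. 3. For $\mathbf k=(k_1,\dots,k_n)\in\mathbb N^n$ let $T_{\mathbf k}=\bigoplus_{\beta_i<p^{k_i}}P_n\,\partial^{[\beta]}$, the subalgebra of $\mathcal D$ generated by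 the $x_i$ and the $\partial_i^{[j]}$ with $j<p^{k_i}$. Then $p^{k_1+\cdots+k_n}$ divides $\dim_K M'$ for every $T_{\mathbf k}$-module $M'$ that is finite dimensional over $K$. -/

import Mathlib

open Polynomial Filter

universe u v w

/-! ## Rings of differential operators -/

section DiffOp

variable (K A : Type*) [Field K] [CommRing A] [Algebra K A]

/-- The `K`-linear differential operators of order at most `i` on a commutative `K`-algebra `A`:
those of order at most `0` are the `A`-linear endomorphisms of `A`, and `f` has order at most
`i + 1` when `f a - a f` has order at most `i` for all `a` in `A`. -/
def diffOpOrder : ℕ → Submodule K (Module.End K A)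
  | 0 =>
    { carrier := {f | ∀ a : A, f * Algebra.lmul K A a - Algebra.lmul K A a * f = 0}
      zero_mem' := by intro a; simp
      add_mem' := by
        intro f g hf hg a
        have h : (f + g) * Algebra.lmul K A a - Algebra.lmul K A a * (f + g)
            = (f * Algebra.lmul K A a - Algebra.lmul K A a * f)
              + (g * Algebra.lmul K A a - Algebra.lmul K A a * g) := by noncomm_ring
        rw [h, hf a, hg a, add_zero]
      smul_mem' := by
        intro c f hf a
        rw [smul_mul_assoc, mul_smul_comm, ← smul_sub, hf a, smul_zero] }
  | i + 1 =>
    { carrier := {f | ∀ a : A, f * Algebra.lmul K A a - Algebra.lmul K A a * f ∈ diffOpOrder i}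
      zero_mem' := by intro a; simp
      add_mem' := by
        intro f g hf hg a
        have h : (f + g) * Algebra.lmul K A a - Algebra.lmul K A a * (f + g)
            = (f * Algebra.lmul K A a - Algebra.lmul K A a * f)
              + (g * Algebra.lmul K A a - Algebra.lmul K A a * g) := by noncomm_ring
        rw [h]
        exact Submodule.add_mem _ (hf a) (hg a)
      smul_mem' := by
        intro c f hf a
        rw [smul_mul_assoc, mul_smul_comm, ← smul_sub]
        exact Submodule.smul_mem _ c (hf a) }

variable {K A}

theorem mem_diffOpOrder_zero {f : Module.End K A} :
    f ∈ diffOpOrder K A 0 ↔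
      ∀ a : A, f * Algebra.lmul K A a - Algebra.lmul K A a * f = 0 := by
  rw [diffOpOrder]; exact Iff.rfl

theorem mem_diffOpOrder_succ {i : ℕ} {f : Module.End K A} :
    f ∈ diffOpOrder K A (i + 1) ↔
      ∀ a : A, f * Algebra.lmul K A a - Algebra.lmul K A a * f ∈ diffOpOrder K A i := by
  rw [diffOpOrder]; exact Iff.rfl

theorem diffOpOrder_le_succ (i : ℕ) : diffOpOrder K A i ≤ diffOpOrder K A (i + 1) := by
  induction i with
  | zero =>
    intro f hf
    rw [mem_diffOpOrder_succ]
    intro a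
    rw [mem_diffOpOrder_zero.1 hf a]
    exact Submodule.zero_mem _
  | succ i ih =>
    intro f hf
    rw [mem_diffOpOrder_succ]
    intro a
    exact ih (mem_diffOpOrder_succ.1 hf a)

theorem diffOpOrder_mono : Monotone (diffOpOrder K A) :=
  monotone_nat_of_le_succ diffOpOrder_le_succ

theorem diffOpOrder_mul_aux (N : ℕ) : ∀ i j : ℕ, i + j = N → ∀ f g : Module.End K A,
    f ∈ diffOpOrder K A i → g ∈ diffOpOrder K A j → f * g ∈ diffOpOrder K A N := by
  have key : ∀ (f g : Module.End K A) (a : A),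
      f * g * Algebra.lmul K A a - Algebra.lmul K A a * (f * g)
        = f * (g * Algebra.lmul K A a - Algebra.lmul K A a * g)
          + (f * Algebra.lmul K A a - Algebra.lmul K A a * f) * g := by
    intro f g a
    rw [mul_sub, sub_mul, mul_assoc, mul_assoc, mul_assoc]
    abel
  induction N with
  | zero =>
    intro i j hij f g hf hg
    obtain ⟨rfl, rfl⟩ : i = 0 ∧ j = 0 := by omega
    rw [mem_diffOpOrder_zero]
    intro a
    rw [key, mem_diffOpOrder_zero.1 hf a, mem_diffOpOrder_zero.1 hg a, mul_zero, zero_mul,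
      add_zero]
  | succ N ih =>
    intro i j hij f g hf hg
    rw [mem_diffOpOrder_succ]
    intro a
    rw [key]
    refine Submodule.add_mem _ ?_ ?_
    · cases j with
      | zero => rw [mem_diffOpOrder_zero.1 hg a, mul_zero]; exact Submodule.zero_mem _
      | succ j => exact ih i j (by omega) _ _ hf (mem_diffOpOrder_succ.1 hg a)
    · cases i with
      | zero => rw [mem_diffOpOrder_zero.1 hf a, zero_mul]; exact Submodule.zero_mem _
      | succ i => exact ih i j (by omega) _ _ (mem_diffOpOrder_succ.1 hf a) hg

variable (K A)

/-- The ring `𝒟(A)` of `K`-linear differential operators on a commutative `K`-algebra `A`, the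
union of the operators of order at most `i` over all `i`, as a subalgebra of `End_K(A)`. -/
def diffOp : Subalgebra K (Module.End K A) where
  carrier := {f | ∃ i : ℕ, f ∈ diffOpOrder K A i}
  mul_mem' := by
    rintro f g ⟨i, hf⟩ ⟨j, hg⟩
    exact ⟨i + j, diffOpOrder_mul_aux (i + j) i j rfl f g hf hg⟩
  add_mem' := by
    rintro f g ⟨i, hf⟩ ⟨j, hg⟩
    exact ⟨max i j, Submodule.add_mem _ (diffOpOrder_mono (le_max_left i j) hf)
      (diffOpOrder_mono (le_max_right i j) hg)⟩
  algebraMap_mem' := by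
    intro c
    refine ⟨0, mem_diffOpOrder_zero.2 fun a => ?_⟩
    rw [Algebra.commutes, sub_self]

end DiffOp

/-! ## Differential operators on the polynomial algebra `P_n` and the canonical filtration -/

section PolyDiffOp

variable (K : Type*) [Field K] (n : ℕ)

/-- `𝒟(P_n)` with `P_n = K[x_1, …, x_n]`. -/
abbrev PolyDiffOp : Type _ := ↥(diffOp K (MvPolynomial (Fin n) K))

variable {n}

/-- The operator `∂^[β] = ∂^β / β! = ∂_1^[β_1] ⋯ ∂_n^[β_n]` (divided powers) on `P_n`:
`x^γ ↦ ∏ i, (γ_i choose β_i) x^(γ - β)`, which is `0` unless `β ≤ γ`. -/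
noncomputable def dividedPartial (β : Fin n →₀ ℕ) : Module.End K (MvPolynomial (Fin n) K) :=
  (MvPolynomial.basisMonomials (Fin n) K).constr K
    fun γ => MvPolynomial.monomial (γ - β) ((∏ i, (γ i).choose (β i) : ℕ) : K)

/-- Multiplication by `x^α` on `P_n`. -/
noncomputable def mulMonomial (α : Fin n →₀ ℕ) : Module.End K (MvPolynomial (Fin n) K) :=
  Algebra.lmul K (MvPolynomial (Fin n) K) (MvPolynomial.monomial α 1)

variable (n)

/-- The canonical filtration `F_i`, the `K`-span in `𝒟(P_n)` of the operators `x^α ∂^[β]` with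
`|α| + |β| ≤ i`. -/
noncomputable def canonicalFiltration (i : ℕ) : Submodule K (PolyDiffOp K n) :=
  (Submodule.span K {f : Module.End K (MvPolynomial (Fin n) K) |
    ∃ α β : Fin n →₀ ℕ, α.degree + β.degree ≤ i ∧
      f = mulMonomial K α * dividedPartial K β}).comap
    (diffOp K (MvPolynomial (Fin n) K)).val.toLinearMap

/-- The subalgebra `T_k` of `𝒟(P_n)`, for `k = (k_1, …, k_n)`, generated by the `x_i` and the
`∂_i^[j]` with `j < p^(k_i)`; as a vector space it is the span of the `x^α ∂^[β]` with
`β_i < p^(k_i)` for all `i`. -/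
noncomputable def truncatedDiffOp (p : ℕ) (k : Fin n → ℕ) :
    Subalgebra K (Module.End K (MvPolynomial (Fin n) K)) :=
  Algebra.adjoin K
    ({f | ∃ i, f = mulMonomial K (Finsupp.single i 1)} ∪
      {f | ∃ i, ∃ j, j < p ^ k i ∧ f = dividedPartial K (Finsupp.single i j)})

end PolyDiffOp

/-! ## Filtrations -/

section Filtrations

variable {K A : Type*} [Field K] [Semiring A] [Algebra K A]

/-- A finite dimensional filtration of a `K`-algebra. -/
structure IsFinDimFiltration (F : ℕ → Submodule K A) : Prop where
  mono : Monotone F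
  exhaustive : ∀ a : A, ∃ i, a ∈ F i
  one_mem : (1 : A) ∈ F 0
  mul_mem : ∀ i j : ℕ, ∀ a ∈ F i, ∀ b ∈ F j, a * b ∈ F (i + j)
  finiteDimensional : ∀ i, Module.Finite K (F i)

/-- Equivalence of filtrations. -/
def FiltrationEquiv (F G : ℕ → Submodule K A) : Prop :=
  ∃ a b c d : ℕ, 0 < a ∧ 0 < c ∧ ∀ᶠ i in atTop, F i ≤ G (a * i + b) ∧ G i ≤ F (c * i + d)

/-- The subspace `V M₀`, spanned by the products `v m` with `v ∈ V` and `m ∈ M₀`. -/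
def subspaceSMul {M : Type*} [AddCommGroup M] [Module K M] [Module A M]
    (V : Submodule K A) (M₀ : Submodule K M) : Submodule K M :=
  Submodule.span K {m | ∃ v ∈ V, ∃ x ∈ M₀, m = v • x}

variable (A) in
/-- `M₀` is a finite dimensional subspace of `M` that generates `M` as an `A`-module. -/
def IsGeneratingSubspace {M : Type*} [AddCommGroup M] [Module K M] [Module A M]
    (M₀ : Submodule K M) : Prop :=
  FiniteDimensional K M₀ ∧ Submodule.span A (M₀ : Set M) = ⊤

end Filtrations

/-- A filtration of standard type of `𝒟(P_n)`: a finite dimensional filtration that is equivalent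
to the canonical one. -/
def IsStandardType (K : Type*) [Field K] (n : ℕ) (F : ℕ → Submodule K (PolyDiffOp K n)) : Prop :=
  IsFinDimFiltration F ∧ FiltrationEquiv F (canonicalFiltration K n)

/-! ## Almost polynomials, holonomic modules and multiplicity -/

/-- `f` is an almost polynomial of degree `d` with leading coefficient `c`: a quasi-polynomial
(of some period `k`) all of whose constituents have degree `d` and leading coefficient `c`. -/
def IsAlmostPolynomial (f : ℕ → ℕ) (d : ℕ) (c : ℚ) : Prop :=
  ∃ k : ℕ, 0 < k ∧ ∃ q : ZMod k → ℚ[X],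
    (∀ s, (q s).natDegree = d ∧ (q s).leadingCoeff = c) ∧
      ∀ᶠ i : ℕ in atTop, (f i : ℚ) = (q (i : ZMod k)).eval (i : ℚ)

section Modules

variable (K : Type*) [Field K] (n : ℕ) (M : Type*) [AddCommGroup M] [Module K M]
  [Module (PolyDiffOp K n) M]

/-- A `𝒟(P_n)`-module `M` is holonomic if it is finitely generated and has a filtration
`{F'_i M₀}` of standard type whose dimensions are eventually bounded by a polynomial of
degree `n`. -/
def IsHolonomic : Prop :=
  ∃ F' : ℕ → Submodule K (PolyDiffOp K n), IsStandardType K n F' ∧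
    ∃ M₀ : Submodule K M, IsGeneratingSubspace (PolyDiffOp K n) M₀ ∧
      ∃ q : ℚ[X], q.degree = n ∧
        ∀ᶠ i : ℕ in atTop, (Module.finrank K (subspaceSMul (F' i) M₀) : ℚ) ≤ q.eval (i : ℚ)

variable {M}

/-- The Hilbert function `i ↦ dim_K (F_i M₀)` with respect to the canonical filtration is an almost
polynomial of degree `d` and of multiplicity `e = d! ⬝ (leading coefficient)`; that is,
`dim_K (F_i M₀) = (e / d!) i^d + ⋯`. For generating subspaces `M₀` of `M` the numbers `d` and `e`
are the dimension and the multiplicity of `M`; they do not depend on `M₀`. -/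
def HasMultiplicity (M₀ : Submodule K M) (d : ℕ) (e : ℚ) : Prop :=
  ∃ c : ℚ, IsAlmostPolynomial
      (fun i => Module.finrank K (subspaceSMul (canonicalFiltration K n i) M₀)) d c ∧
    e = (d.factorial : ℚ) * c

end Modules

/-! Write q = p^k. In characteristic p the commutator of ∂^[β] with x_i^q is ∂^[β - q e_i], or 0 if
β_i < q (`dp_mul_mon_pow`). Hence the centralizer T of all the x_i^q contains every x^α and every
∂^[r] with r_i < q, and 𝒟 is a free right T-module on the ∂^[β] with q ∣ β_i for all i: these span
because ∂^[β + r] = ∂^[β] ∂^[r] for such β and r, and iterated commutators with the x_i^q read off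
the coefficients (`isFreeOn_centralizer`).

A finite presentation involves finitely many operators, so for k large its relations have entries in
T, and M is in effect induced from a T-module (`exists_isFreeOn`). Let V_j be the span of the x^α
∂^[r] M₀ with r_i < q and |α| + |r| ≤ j. Then F_i M₀ is the direct sum of the ∂^[β] V_{i - |β|} over
q ∣ β (`finrank_subspaceSMul_opSpan`), so the Hilbert series of M is (∑ dim V_j t^j) / (1 - t^q)^n.

If the V_j did not become stationary, their dimensions would grow at least linearly and the Hilbert
function would have growth of degree at least n + 1, against holonomicity
(`exists_boxFiltration_stationary`). The stationary value V is finite dimensional and stable under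
the x_i and the ∂^[r], r_i < q. These operators generate a q^n by q^n matrix algebra over K[x_1^q,
…, x_n^q], so its matrix units show that q^n divides dim V (`card_dvd_finrank_of_matrixUnits`). The
leading coefficient dim V / (q^n n!) is therefore e / n! with e an integer. The same matrix units,
with a separate k_i for each variable, give the third statement.

For small multiplicities, divide 𝒟 by the left ideal generated by the ∂_i^[r], 0 < r < q, and by
x_j^q for all but m of the variables. Here V_j has as basis the monomials of degree at most j whose
truncated exponents are below q, so the Hilbert series is 1 / ((1 - t)^(n+1) (1 - t^q)^m)
(`mk_card_smallExp`). This gives dimension n + m and multiplicity q^(-m). -/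

/-! ## Binomial coefficients in characteristic `p` -/

section Choose

variable {K : Type*} [Field K] (p : ℕ) [Fact p.Prime] [CharP K p]

/-- Compare coefficients in (X + 1)^(m + q) = (X + 1)^m (X^q + 1), q = p^k. Both the Lucas-type
congruences below and the commutation of ∂^[β] with x_i^q come from this identity. -/
theorem cast_choose_add_pow (k m b : ℕ) :
    ((m + p ^ k).choose b : K)
      = m.choose b + if p ^ k ≤ b then (m.choose (b - p ^ k) : K) else 0 := by
  have h : (X + 1 : K[X]) ^ (m + p ^ k) = (X + 1) ^ m + (X + 1) ^ m * X ^ (p ^ k) := by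
    rw [pow_add, add_pow_char_pow, one_pow]
    ring
  have h2 := congrArg (fun f => Polynomial.coeff f b) h
  simpa only [Polynomial.coeff_add, Polynomial.coeff_X_add_one_pow, Polynomial.coeff_mul_X_pow']
    using h2

theorem cast_choose_of_lt (k : ℕ) {j : ℕ} (hj : j < p ^ k) (r b : ℕ) :
    ((p ^ k * b + r).choose j : K) = r.choose j := by
  induction b with
  | zero => simp
  | succ b ih =>
    rw [show p ^ k * (b + 1) + r = p ^ k * b + r + p ^ k by ring, cast_choose_add_pow p, ih,
      if_neg (by omega), add_zero]

theorem cast_choose_mod (k : ℕ) {j : ℕ} (hj : j < p ^ k) (m : ℕ) :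
    (m.choose j : K) = (m % p ^ k).choose j := by
  conv_lhs => rw [← Nat.div_add_mod m (p ^ k)]
  exact cast_choose_of_lt p k hj _ _

/-- Removing the carry leaves r + s - q < r. Consequently a product ∂^[r] ∂^[s] that would leave the
box of exponents below q vanishes. -/
theorem cast_choose_eq_zero_of_overflow (k : ℕ) {r s : ℕ} (hr : r < p ^ k) (hs : s < p ^ k)
    (h : p ^ k ≤ r + s) : ((r + s).choose r : K) = 0 := by
  have := cast_choose_of_lt (K := K) p k hr (r + s - p ^ k) 1
  rw [show p ^ k * 1 + (r + s - p ^ k) = r + s by omega] at this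
  rw [this, Nat.choose_eq_zero_of_lt (by omega), Nat.cast_zero]

/-- Only m mod q matters, and then the sum is the full alternating binomial sum. It is the
eigenvalue on x^m of the one-variable operator ∑ (-1)^j x^j ∂^[j], which is thus a projection. -/
theorem sum_neg_one_pow_mul_cast_choose (k m : ℕ) :
    ∑ j ∈ Finset.range (p ^ k), (-1 : K) ^ j * (m.choose j : K)
      = if m % p ^ k = 0 then 1 else 0 := by
  have hq : 0 < p ^ k := pow_pos (Fact.out : p.Prime).pos k
  set r := m % p ^ k with hr
  have h1 : ∑ j ∈ Finset.range (p ^ k), (-1 : K) ^ j * (m.choose j : K)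
      = ∑ j ∈ Finset.range (r + 1), (-1 : K) ^ j * (r.choose j : K) := by
    rw [Finset.sum_congr rfl fun j hj => by
      rw [cast_choose_mod p k (Finset.mem_range.1 hj) m]]
    symm
    apply Finset.sum_subset
    · intro j hj
      have := Nat.mod_lt m hq
      simp only [Finset.mem_range] at *
      omega
    · intro j _ hj
      rw [Nat.choose_eq_zero_of_lt (by simpa [Nat.lt_succ_iff] using hj)]
      simp
  rw [h1]
  have h2 := congrArg (fun z : ℤ => (z : K)) (Int.alternating_sum_range_choose (n := r))
  simpa using h2

end Choose

/-! ## Relations between the operators `x^α` and `∂^[β]` -/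

section Relations

variable {K : Type*} [Field K] {n : ℕ}

theorem end_ext {f g : Module.End K (MvPolynomial (Fin n) K)}
    (h : ∀ γ, f (MvPolynomial.monomial γ 1) = g (MvPolynomial.monomial γ 1)) : f = g :=
  (MvPolynomial.basisMonomials (Fin n) K).ext fun γ => by
    simpa [MvPolynomial.coe_basisMonomials] using h γ

theorem dividedPartial_monomial (β γ : Fin n →₀ ℕ) (c : K) :
    dividedPartial K β (MvPolynomial.monomial γ c)
      = MvPolynomial.monomial (γ - β) (c * ∏ i, ((γ i).choose (β i) : K)) := by
  have h := (MvPolynomial.basisMonomials (Fin n) K).constr_basis K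
    (fun γ => MvPolynomial.monomial (γ - β) ((∏ i, (γ i).choose (β i) : ℕ) : K)) γ
  rw [MvPolynomial.coe_basisMonomials] at h
  rw [← mul_one c, ← smul_eq_mul, ← MvPolynomial.smul_monomial, map_smul, dividedPartial, h,
    MvPolynomial.smul_monomial]
  simp

theorem mulMonomial_apply (α : Fin n →₀ ℕ) (f : MvPolynomial (Fin n) K) :
    mulMonomial K α f = MvPolynomial.monomial α 1 * f := rfl

theorem mulMonomial_monomial (α γ : Fin n →₀ ℕ) (c : K) :
    mulMonomial K α (MvPolynomial.monomial γ c) = MvPolynomial.monomial (α + γ) c := by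
  rw [mulMonomial_apply, MvPolynomial.monomial_mul, one_mul]

theorem mulMonomial_add (α α' : Fin n →₀ ℕ) :
    mulMonomial K (α + α') = mulMonomial K α * mulMonomial K α' :=
  end_ext fun γ => by
    simp [mulMonomial_monomial, add_assoc]

theorem mulMonomial_zero : mulMonomial K (0 : Fin n →₀ ℕ) = 1 :=
  end_ext fun γ => by simp [mulMonomial_monomial]

theorem dividedPartial_zero : dividedPartial K (0 : Fin n →₀ ℕ) = 1 :=
  end_ext fun γ => by simp [dividedPartial_monomial]

theorem prod_choose_eq_zero {γ β : Fin n →₀ ℕ} (h : ¬ β ≤ γ) :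
    ∏ i, ((γ i).choose (β i) : K) = 0 := by
  obtain ⟨i, hi⟩ : ∃ i, ¬ β i ≤ γ i := by simpa [Finsupp.le_def] using h
  exact Finset.prod_eq_zero (Finset.mem_univ i) (by rw [Nat.choose_eq_zero_of_lt (by omega)]; simp)

theorem dividedPartial_mul (β γ : Fin n →₀ ℕ) :
    dividedPartial K β * dividedPartial K γ
      = (∏ i, ((β i + γ i).choose (β i) : K)) • dividedPartial K (β + γ) := by
  refine end_ext fun δ => ?_
  rw [Module.End.mul_apply, LinearMap.smul_apply]
  simp only [dividedPartial_monomial, one_mul, MvPolynomial.smul_monomial, smul_eq_mul]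
  rw [tsub_tsub, add_comm γ β, ← Finset.prod_mul_distrib, ← Finset.prod_mul_distrib]
  congr 1
  refine Finset.prod_congr rfl fun i _ => ?_
  -- The identity C(δ, β+γ) C(β+γ, γ) = C(δ, γ) C(δ-γ, β) in each coordinate.
  have h := Nat.choose_mul (n := δ i) (k := β i + γ i) (s := γ i) (by omega)
  rw [Nat.add_sub_cancel, ← Nat.choose_symm_add] at h
  simp only [Finsupp.add_apply, Finsupp.tsub_apply]
  rw [← Nat.cast_mul, ← Nat.cast_mul, ← h, mul_comm]

/-- Adding p^k to one exponent changes a binomial coefficient by a single term, so x_i^(p^k)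
commutes with ∂^[β] up to one lower divided power, as x_i itself does. -/
theorem dividedPartial_mul_mulMonomial_pow (p : ℕ) [Fact p.Prime] [CharP K p] (k : ℕ)
    (β : Fin n →₀ ℕ) (i : Fin n) :
    dividedPartial K β * mulMonomial K (Finsupp.single i (p ^ k))
      = mulMonomial K (Finsupp.single i (p ^ k)) * dividedPartial K β
        + if Finsupp.single i (p ^ k) ≤ β then dividedPartial K (β - Finsupp.single i (p ^ k))
          else 0 := by
  refine end_ext fun γ => ?_
  set q := p ^ k with hq
  rw [LinearMap.add_apply, Module.End.mul_apply, Module.End.mul_apply]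
  have hC : ∏ j, (((Finsupp.single i q + γ) j).choose (β j) : K)
      = ∏ j, ((γ j).choose (β j) : K) +
        if Finsupp.single i q ≤ β then ∏ j, ((γ j).choose ((β - Finsupp.single i q) j) : K)
        else 0 := by
    rw [← Finset.mul_prod_erase _ _ (Finset.mem_univ i),
      ← Finset.mul_prod_erase Finset.univ (fun j => ((γ j).choose (β j) : K)) (Finset.mem_univ i),
      ← Finset.mul_prod_erase Finset.univ
        (fun j => ((γ j).choose ((β - Finsupp.single i q) j) : K)) (Finset.mem_univ i)]
    have e1 : ∏ j ∈ Finset.univ.erase i, (((Finsupp.single i q + γ) j).choose (β j) : K)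
        = ∏ j ∈ Finset.univ.erase i, ((γ j).choose (β j) : K) :=
      Finset.prod_congr rfl fun j hj => by
        simp [Finsupp.single_eq_of_ne (Finset.ne_of_mem_erase hj)]
    have e2 : ∏ j ∈ Finset.univ.erase i, ((γ j).choose ((β - Finsupp.single i q) j) : K)
        = ∏ j ∈ Finset.univ.erase i, ((γ j).choose (β j) : K) :=
      Finset.prod_congr rfl fun j hj => by
        simp [Finsupp.single_eq_of_ne (Finset.ne_of_mem_erase hj)]
    rw [e1, e2, Finsupp.add_apply, Finsupp.single_eq_same, add_comm q, cast_choose_add_pow p,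
      Finsupp.tsub_apply, Finsupp.single_eq_same]
    simp only [Finsupp.single_le_iff, ← hq]
    split_ifs <;> ring
  -- Truncated subtraction makes the two exponents differ in general, but unless β ≤ γ the
  -- coefficient is zero.
  have h1 : MvPolynomial.monomial (Finsupp.single i q + γ - β) (∏ j, ((γ j).choose (β j) : K))
      = MvPolynomial.monomial (Finsupp.single i q + (γ - β)) (∏ j, ((γ j).choose (β j) : K)) := by
    by_cases h : β ≤ γ
    · rw [add_tsub_assoc_of_le h]
    · simp [prod_choose_eq_zero h]
  simp only [mulMonomial_monomial, dividedPartial_monomial, one_mul]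
  rw [hC, map_add, h1]
  congr 1
  split_ifs with h
  · rw [dividedPartial_monomial, one_mul]
    congr 2
    ext j
    have := h j
    simp only [Finsupp.tsub_apply, Finsupp.add_apply]
    omega
  · simp

theorem dividedPartial_mul_X (β : Fin n →₀ ℕ) (i : Fin n) (p : ℕ) [Fact p.Prime] [CharP K p] :
    dividedPartial K β * mulMonomial K (Finsupp.single i 1)
      = mulMonomial K (Finsupp.single i 1) * dividedPartial K β
        + if Finsupp.single i 1 ≤ β then dividedPartial K (β - Finsupp.single i 1) else 0 := by
  simpa using dividedPartial_mul_mulMonomial_pow (K := K) p 0 β i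

end Relations

/-! ## Matrix units in `T_k` -/

section MatrixUnits

/-- Peirce decomposition: V is a sum of copies of the image of one diagonal idempotent `e o o`, one
for each index, through v ↦ (e_{oa} v)_a with inverse w ↦ ∑ e_{ao} w_a. -/
theorem card_dvd_finrank_of_matrixUnits {K V ι : Type*} [Field K] [AddCommGroup V] [Module K V]
    [FiniteDimensional K V] [Fintype ι] [DecidableEq ι] (e : ι → ι → Module.End K V)
    (hmul : ∀ a b c d, e a b * e c d = if b = c then e a d else 0) (hone : ∑ a, e a a = 1) :
    Fintype.card ι ∣ Module.finrank K V := by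
  cases isEmpty_or_nonempty ι with
  | inl h =>
    have : Subsingleton V := by
      refine ⟨fun x y => ?_⟩
      have h1 : (1 : Module.End K V) = 0 := by rw [← hone]; simp
      rw [← Module.End.one_apply (R := K) x, ← Module.End.one_apply (R := K) y, h1]; simp
    simp [Module.finrank_zero_of_subsingleton]
  | inr h =>
    obtain ⟨o⟩ := h
    have hm : ∀ a b c d v, e a b (e c d v) = if b = c then e a d v else 0 := by
      intro a b c d v
      rw [← Module.End.mul_apply, hmul]
      split_ifs <;> simp
    let W := LinearMap.range (e o o)
    have hW : ∀ w ∈ W, e o o w = w := by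
      rintro _ ⟨v, rfl⟩
      simp [hm]
    let f : V →ₗ[K] (ι → W) := LinearMap.pi fun a =>
      (e o a).codRestrict W fun v => ⟨e o a v, by simp [hm]⟩
    let g : (ι → W) →ₗ[K] V := ∑ a, (e a o ∘ₗ W.subtype) ∘ₗ LinearMap.proj a
    have hg : ∀ w, g w = ∑ a, e a o (w a) := fun w => by simp [g]
    have equiv : V ≃ₗ[K] (ι → W) := LinearEquiv.ofLinearMap f g
      (by
        refine LinearMap.ext fun w => funext fun a => Subtype.ext ?_
        show e o a (g w) = w a
        rw [hg, map_sum]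
        simp [hm, hW])
      (by
        refine LinearMap.ext fun v => ?_
        show g (f v) = v
        rw [hg]
        have : ∀ a, e a o ((f v a : W) : V) = e a a v := fun a => by
          show e a o (e o a v) = _
          simp [hm]
        simp only [this]
        rw [← LinearMap.sum_apply, hone, Module.End.one_apply])
    rw [equiv.finrank_eq, Module.finrank_pi_fintype]
    simp

/-! ### The matrix units realized as differential operators -/

variable {K : Type*} [Field K] {n : ℕ} {p : ℕ} {k : Fin n → ℕ}

theorem mulMonomial_mem_truncatedDiffOp (α : Fin n →₀ ℕ) :
    mulMonomial K α ∈ truncatedDiffOp K n p k := by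
  induction α using Finsupp.induction_linear with
  | zero => rw [mulMonomial_zero]; exact one_mem _
  | add f g hf hg => rw [mulMonomial_add]; exact mul_mem hf hg
  | single i m =>
    induction m with
    | zero => rw [Finsupp.single_zero, mulMonomial_zero]; exact one_mem _
    | succ m ih =>
      rw [Finsupp.single_add, mulMonomial_add]
      exact mul_mem ih (Algebra.subset_adjoin (Or.inl ⟨i, rfl⟩))

theorem dividedPartial_mem_of_single {S : Subalgebra K (Module.End K (MvPolynomial (Fin n) K))}
    (β : Fin n →₀ ℕ) (h : ∀ i, dividedPartial K (Finsupp.single i (β i)) ∈ S) :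
    dividedPartial K β ∈ S := by
  induction β using Finsupp.induction with
  | zero => rw [dividedPartial_zero]; exact one_mem _
  | single_add i b f hi hb ih =>
    have hf : f i = 0 := by simpa using hi
    have h1 := dividedPartial_mul (K := K) (Finsupp.single i b) f
    have h2 : ∏ j, ((Finsupp.single i b j + f j).choose (Finsupp.single i b j) : K) = 1 := by
      refine Finset.prod_eq_one fun j _ => ?_
      by_cases hj : j = i
      · subst hj; simp [hf]
      · simp [Finsupp.single_eq_of_ne hj]
    rw [h2, one_smul] at h1
    rw [← h1]
    refine mul_mem ?_ (ih fun j => ?_)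
    · simpa [hf] using h i
    · by_cases hj : j = i
      · subst hj; rw [hf, Finsupp.single_zero, dividedPartial_zero]; exact one_mem _
      · simpa [Finsupp.single_eq_of_ne hj] using h j

theorem dividedPartial_mem_truncatedDiffOp (β : Fin n →₀ ℕ) (h : ∀ i, β i < p ^ k i) :
    dividedPartial K β ∈ truncatedDiffOp K n p k :=
  dividedPartial_mem_of_single β fun i => Algebra.subset_adjoin (Or.inr ⟨i, β i, h i, rfl⟩)

variable (K p k) in
/-- The projection of `P_n` onto the span of the monomials all of whose exponents are divisible by
the `p ^ k i`. -/
noncomputable def frobeniusProj : Module.End K (MvPolynomial (Fin n) K) :=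
  ∑ r ∈ Fintype.piFinset fun i => Finset.range (p ^ k i),
    (∏ i, (-1 : K) ^ r i) •
      (mulMonomial K (Finsupp.equivFunOnFinite.symm r)
        * dividedPartial K (Finsupp.equivFunOnFinite.symm r))

theorem frobeniusProj_mem : frobeniusProj K p k ∈ truncatedDiffOp K n p k := by
  refine sum_mem fun r hr => Subalgebra.smul_mem _ (mul_mem (mulMonomial_mem_truncatedDiffOp _)
    (dividedPartial_mem_truncatedDiffOp _ fun i => ?_)) _
  simpa using Fintype.mem_piFinset.1 hr i

theorem mulMonomial_dividedPartial_monomial (β γ : Fin n →₀ ℕ) :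
    (mulMonomial K β * dividedPartial K β) (MvPolynomial.monomial γ 1)
      = (∏ i, ((γ i).choose (β i) : K)) • MvPolynomial.monomial γ 1 := by
  rw [Module.End.mul_apply, dividedPartial_monomial, mulMonomial_monomial,
    MvPolynomial.smul_monomial]
  by_cases h : β ≤ γ
  · rw [add_tsub_cancel_of_le h]; simp
  · simp [prod_choose_eq_zero h]

/-- The exponents `a` with `a i < p ^ k i`. -/
abbrev BoxIndex (p : ℕ) (k : Fin n → ℕ) : Type := ∀ i, Fin (p ^ k i)

/-- An element of `BoxIndex` as an exponent. -/
noncomputable def BoxIndex.exp (a : BoxIndex p k) : Fin n →₀ ℕ :=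
  Finsupp.equivFunOnFinite.symm fun i => (a i : ℕ)

@[simp] theorem BoxIndex.exp_apply (a : BoxIndex p k) (i : Fin n) : a.exp i = a i := rfl

/-- The matrix unit `x^a π ∂^[b]`. -/
noncomputable def matrixUnit (a b : BoxIndex p k) : Module.End K (MvPolynomial (Fin n) K) :=
  mulMonomial K a.exp * frobeniusProj K p k * dividedPartial K b.exp

theorem matrixUnit_mem (a b : BoxIndex p k) :
    matrixUnit (K := K) a b ∈ truncatedDiffOp K n p k :=
  mul_mem (mul_mem (mulMonomial_mem_truncatedDiffOp _) frobeniusProj_mem)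
    (dividedPartial_mem_truncatedDiffOp _ fun i => (b i).2)

variable [Fact p.Prime] [CharP K p]

theorem frobeniusProj_monomial (γ : Fin n →₀ ℕ) :
    frobeniusProj K p k (MvPolynomial.monomial γ 1)
      = if ∀ i, γ i % p ^ k i = 0 then MvPolynomial.monomial γ 1 else 0 := by
  rw [frobeniusProj, LinearMap.sum_apply]
  simp only [LinearMap.smul_apply, mulMonomial_dividedPartial_monomial]
  simp only [← smul_assoc, smul_eq_mul, ← Finset.prod_mul_distrib, ← Finset.sum_smul]
  have h := Finset.prod_univ_sum (fun i : Fin n => Finset.range (p ^ k i))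
    (fun i j => (-1 : K) ^ j * ((γ i).choose j : K))
  simp only [Finsupp.equivFunOnFinite_symm_apply_apply]
  rw [← h]
  simp only [sum_neg_one_pow_mul_cast_choose]
  split_ifs with h0
  · rw [Finset.prod_congr rfl fun i _ => if_pos (h0 i)]; simp
  · push Not at h0
    obtain ⟨i, hi⟩ := h0
    rw [Finset.prod_eq_zero (Finset.mem_univ i) (if_neg hi), zero_smul]

/-- P_n is free over the polynomials in the x_i^(p^(k_i)) on the x^a with a in the box, and the
operator exchanges the residue b for a. The binomial factor is 1 because γ_i ≡ b_i reduces it to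
C(b_i, b_i). -/
theorem matrixUnit_monomial (a b : BoxIndex p k) (γ : Fin n →₀ ℕ) :
    matrixUnit a b (MvPolynomial.monomial γ (1 : K))
      = if ∀ i, γ i % p ^ k i = b i then MvPolynomial.monomial (a.exp + (γ - b.exp)) 1 else 0 := by
  rw [matrixUnit, Module.End.mul_apply, Module.End.mul_apply, dividedPartial_monomial, one_mul,
    ← mul_one (∏ _, _), ← smul_eq_mul, ← MvPolynomial.smul_monomial, map_smul,
    frobeniusProj_monomial]
  by_cases hb : b.exp ≤ γ
  · have key : (∀ i, (γ - b.exp) i % p ^ k i = 0) ↔ ∀ i, γ i % p ^ k i = b i := by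
      refine forall_congr' fun i => ?_
      have h1 : (b i : ℕ) ≤ γ i := hb i
      rw [Finsupp.tsub_apply, BoxIndex.exp_apply]
      have h2 := Nat.mod_eq_of_lt (b i).2
      constructor
      · intro h
        have h3 : (b i : ℕ) ≡ γ i [MOD p ^ k i] := (Nat.modEq_iff_dvd' h1).2 (Nat.dvd_of_mod_eq_zero h)
        rw [← h3, h2]
      · intro h
        exact Nat.mod_eq_zero_of_dvd ((Nat.modEq_iff_dvd' h1).1 (h2.trans h.symm))
    by_cases h : ∀ i, γ i % p ^ k i = b i
    · rw [if_pos (key.2 h), if_pos h]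
      have : ∏ i, ((γ i).choose (b.exp i) : K) = 1 := Finset.prod_eq_one fun i _ => by
        rw [BoxIndex.exp_apply, cast_choose_mod p (k i) (b i).2, h i, Nat.choose_self, Nat.cast_one]
      rw [this, one_smul, mulMonomial_monomial]
    · rw [if_neg (mt key.1 h), if_neg h]; simp
  · rw [prod_choose_eq_zero hb, zero_smul, map_zero, if_neg]
    intro h
    exact hb fun i => by rw [BoxIndex.exp_apply, ← h i]; exact Nat.mod_le _ _

theorem matrixUnit_mul (a b c d : BoxIndex p k) :
    matrixUnit (K := K) a b * matrixUnit c d = if b = c then matrixUnit a d else 0 := by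
  refine end_ext fun γ => ?_
  rw [Module.End.mul_apply, matrixUnit_monomial]
  by_cases hd : ∀ i, γ i % p ^ k i = d i
  · rw [if_pos hd, matrixUnit_monomial]
    have h1 : ∀ i, (c.exp + (γ - d.exp)) i % p ^ k i = c i := fun i => by
      rw [Finsupp.add_apply, Finsupp.tsub_apply, BoxIndex.exp_apply, BoxIndex.exp_apply, ← hd i,
        Nat.add_mod]
      simp [Nat.mod_eq_of_lt (c i).2, Nat.mod_eq_zero_of_dvd (Nat.dvd_sub_mod (γ i))]
    have h2 : (∀ i, (c.exp + (γ - d.exp)) i % p ^ k i = b i) ↔ b = c := by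
      constructor
      · intro h
        funext i
        exact Fin.ext ((h i).symm.trans (h1 i))
      · rintro rfl
        exact h1
    simp only [h2]
    split_ifs with hbc
    · subst hbc
      rw [matrixUnit_monomial, if_pos hd, add_tsub_cancel_left]
    · simp
  · rw [if_neg hd, map_zero]
    split_ifs
    · rw [matrixUnit_monomial, if_neg hd]
    · simp

theorem sum_matrixUnit : ∑ a : BoxIndex p k, matrixUnit (K := K) a a = 1 := by
  have hq : ∀ i, 0 < p ^ k i := fun i => pow_pos (Fact.out : p.Prime).pos _
  refine end_ext fun γ => ?_
  rw [LinearMap.sum_apply]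
  simp only [matrixUnit_monomial]
  rw [Finset.sum_eq_single (fun i => ⟨γ i % p ^ k i, Nat.mod_lt _ (hq i)⟩)]
  · rw [if_pos fun i => rfl, add_tsub_cancel_of_le, Module.End.one_apply]
    intro i
    exact Nat.mod_le _ _
  · intro b _ hb
    rw [if_neg]
    intro h
    exact hb (funext fun i => Fin.ext (h i).symm)
  · simp

theorem pow_dvd_finrank_of_module (M : Type*) [AddCommGroup M] [Module K M]
    [Module (truncatedDiffOp K n p k) M] [IsScalarTower K (truncatedDiffOp K n p k) M]
    [FiniteDimensional K M] : p ^ (∑ i, k i) ∣ Module.finrank K M := by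
  have : SMulCommClass (truncatedDiffOp K n p k) K M := IsScalarTower.to_smulCommClass'
  let φ := Algebra.lsmul K K M (A := truncatedDiffOp K n p k)
  have h := card_dvd_finrank_of_matrixUnits (K := K) (V := M)
    (fun a b : BoxIndex p k => φ ⟨matrixUnit a b, matrixUnit_mem a b⟩)
    (fun a b c d => by
      rw [← map_mul, MulMemClass.mk_mul_mk]
      simp only [matrixUnit_mul]
      split_ifs with h
      · rfl
      · exact map_zero φ)
    (by
      rw [← map_sum, ← map_one φ]
      congr 1
      apply Subtype.ext
      rw [AddSubmonoidClass.coe_finsetSum]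
      exact sum_matrixUnit)
  simpa [Finset.prod_pow_eq_pow_sum] using h

end MatrixUnits

/-! ## Differential operators on `P_n` are combinations of the `x^α ∂^[β]` -/

section Generation

variable {K : Type*} [Field K] {n : ℕ}

theorem mulMonomial_eq_lmul_X (i : Fin n) :
    mulMonomial K (Finsupp.single i 1) = Algebra.lmul K _ (MvPolynomial.X i) := rfl

theorem mem_finsuppAntidiag_univ {γ : Fin n →₀ ℕ} {m : ℕ} :
    γ ∈ Finset.finsuppAntidiag Finset.univ m ↔ γ.degree = m := by
  simp [Finset.mem_finsuppAntidiag, Finsupp.degree_eq_sum]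

/-- The commutator of an operator with multiplication by `a` can be controlled through the
commutators with the coordinates. -/
theorem commutator_lmul_mem (S : Submodule K (Module.End K (MvPolynomial (Fin n) K)))
    (hl : ∀ a, ∀ g ∈ S, Algebra.lmul K _ a * g ∈ S) (hr : ∀ a, ∀ g ∈ S, g * Algebra.lmul K _ a ∈ S)
    {f : Module.End K (MvPolynomial (Fin n) K)}
    (h : ∀ i, f * mulMonomial K (Finsupp.single i 1) - mulMonomial K (Finsupp.single i 1) * f ∈ S)
    (a : MvPolynomial (Fin n) K) : f * Algebra.lmul K _ a - Algebra.lmul K _ a * f ∈ S := by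
  induction a using MvPolynomial.induction_on with
  | C c =>
    have : Algebra.lmul K (MvPolynomial (Fin n) K) (MvPolynomial.C c)
        = algebraMap K (Module.End K (MvPolynomial (Fin n) K)) c := by
      rw [← MvPolynomial.algebraMap_eq, AlgHom.commutes]
    rw [this, Algebra.commutes, sub_self]
    exact zero_mem _
  | add a b ha hb =>
    rw [map_add, mul_add, add_mul, add_sub_add_comm]
    exact add_mem ha hb
  | mul_X a i ha =>
    -- The Leibniz rule [f, a x_i] = [f, a] x_i + a [f, x_i].
    have e : f * Algebra.lmul K _ (a * MvPolynomial.X i) - Algebra.lmul K _ (a * MvPolynomial.X i) * f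
        = (f * Algebra.lmul K _ a - Algebra.lmul K _ a * f) * Algebra.lmul K _ (MvPolynomial.X i)
        + Algebra.lmul K _ a * (f * mulMonomial K (Finsupp.single i 1)
          - mulMonomial K (Finsupp.single i 1) * f) := by
      rw [map_mul, mulMonomial_eq_lmul_X, sub_mul, mul_sub]
      simp only [mul_assoc]
      abel
    rw [e]
    exact add_mem (hr _ _ ha) (hl _ _ (h i))

theorem lmul_mem_diffOpOrder_zero (a : MvPolynomial (Fin n) K) :
    Algebra.lmul K _ a ∈ diffOpOrder K (MvPolynomial (Fin n) K) 0 :=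
  mem_diffOpOrder_zero.2 fun b => by rw [← map_mul, ← map_mul, mul_comm, sub_self]

theorem mem_diffOpOrder_zero_of_X {f : Module.End K (MvPolynomial (Fin n) K)}
    (h : ∀ i, f * mulMonomial K (Finsupp.single i 1) - mulMonomial K (Finsupp.single i 1) * f = 0) :
    f ∈ diffOpOrder K (MvPolynomial (Fin n) K) 0 :=
  mem_diffOpOrder_zero.2 fun a => (Submodule.mem_bot K).1
    (commutator_lmul_mem ⊥ (by simp) (by simp) (fun i => by simp [h]) a)

theorem mem_diffOpOrder_succ_of_X {j : ℕ} {f : Module.End K (MvPolynomial (Fin n) K)}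
    (h : ∀ i, f * mulMonomial K (Finsupp.single i 1) - mulMonomial K (Finsupp.single i 1) * f
      ∈ diffOpOrder K (MvPolynomial (Fin n) K) j) :
    f ∈ diffOpOrder K (MvPolynomial (Fin n) K) (j + 1) :=
  mem_diffOpOrder_succ.2 fun a => commutator_lmul_mem _
    (fun b _ hg => diffOpOrder_mul_aux j 0 j (zero_add j) _ _ (lmul_mem_diffOpOrder_zero b) hg)
    (fun b _ hg => diffOpOrder_mul_aux j j 0 (add_zero j) _ _ hg (lmul_mem_diffOpOrder_zero b)) h a

/-- Each [f, x_i] has order one less and kills the monomials of degree one less, so it vanishes by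
induction. Then f is P_n-linear and f(1) = 0. -/
theorem eq_zero_of_mem_diffOpOrder {j : ℕ} : ∀ {f : Module.End K (MvPolynomial (Fin n) K)},
    f ∈ diffOpOrder K _ j → (∀ γ : Fin n →₀ ℕ, γ.degree ≤ j → f (MvPolynomial.monomial γ 1) = 0) →
    f = 0 := by
  have base : ∀ {f : Module.End K (MvPolynomial (Fin n) K)},
      f ∈ diffOpOrder K _ 0 → f (MvPolynomial.monomial 0 1) = 0 → f = 0 := by
    intro f hf h
    refine LinearMap.ext fun a => ?_
    have h1 := LinearMap.congr_fun (mem_diffOpOrder_zero.1 hf a) 1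
    have h2 : f 1 = 0 := h
    simpa [h2, sub_eq_zero] using h1
  induction j with
  | zero => exact fun hf h => base hf (h 0 (by simp))
  | succ j ih =>
    intro f hf h
    refine base (mem_diffOpOrder_zero_of_X fun i => ?_) (h 0 (by simp))
    refine ih (mem_diffOpOrder_succ.1 hf _) fun γ hγ => ?_
    rw [LinearMap.sub_apply, Module.End.mul_apply, Module.End.mul_apply]
    rw [mulMonomial_monomial, h _ (by simp [Finsupp.degree_single]; omega), h γ (by omega)]
    simp

theorem degree_tsub_single {β : Fin n →₀ ℕ} {i : Fin n} {m : ℕ} (h : Finsupp.single i m ≤ β) :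
    (β - Finsupp.single i m).degree + m = β.degree := by
  conv_rhs => rw [← tsub_add_cancel_of_le h, map_add, Finsupp.degree_single]

section CharP

variable (p : ℕ) [Fact p.Prime] [CharP K p]

include p in
theorem dividedPartial_mem_diffOpOrder {j : ℕ} : ∀ {β : Fin n →₀ ℕ}, β.degree ≤ j →
    dividedPartial K β ∈ diffOpOrder K _ j := by
  have key : ∀ β : Fin n →₀ ℕ, ∀ i, dividedPartial K β * mulMonomial K (Finsupp.single i 1)
      - mulMonomial K (Finsupp.single i 1) * dividedPartial K β
      = if Finsupp.single i 1 ≤ β then dividedPartial K (β - Finsupp.single i 1) else 0 :=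
    fun β i => by rw [dividedPartial_mul_X β i p, add_sub_cancel_left]
  induction j with
  | zero =>
    intro β hβ
    obtain rfl : β = 0 := (Finsupp.degree_eq_zero_iff β).1 (by omega)
    rw [dividedPartial_zero]
    exact mem_diffOpOrder_zero.2 fun a => by simp
  | succ j ih =>
    intro β hβ
    refine mem_diffOpOrder_succ_of_X fun i => ?_
    rw [key]
    split_ifs with h
    · exact ih (by have := degree_tsub_single h; omega)
    · exact zero_mem _

end CharP

/-- Interpolation degree by degree: the error g in degree m is corrected by ∑ g(x^β) ∂^[β] over |β|
= m, since ∂^[β] takes x^β to 1 and kills every other monomial of degree at most m. With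
`eq_zero_of_mem_diffOpOrder` this shows that the x^α ∂^[β] span 𝒟. -/
theorem exists_combination_dividedPartial (p : ℕ) [Fact p.Prime] [CharP K p]
    (f : Module.End K (MvPolynomial (Fin n) K)) (m : ℕ) :
    ∃ g ∈ Submodule.span K {f : Module.End K (MvPolynomial (Fin n) K) |
        ∃ α β : Fin n →₀ ℕ, f = mulMonomial K α * dividedPartial K β},
      g ∈ diffOpOrder K _ m ∧
      ∀ γ : Fin n →₀ ℕ, γ.degree ≤ m → g (MvPolynomial.monomial γ 1)
        = f (MvPolynomial.monomial γ 1) := by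
  set S := Submodule.span K {f : Module.End K (MvPolynomial (Fin n) K) |
        ∃ α β : Fin n →₀ ℕ, f = mulMonomial K α * dividedPartial K β} with hS
  have hmem : ∀ (a : MvPolynomial (Fin n) K) (β), Algebra.lmul K _ a * dividedPartial K β ∈ S := by
    intro a β
    induction a using MvPolynomial.induction_on' with
    | monomial α c =>
      have : Algebra.lmul K _ (MvPolynomial.monomial α c) * dividedPartial K β
          = c • (mulMonomial K α * dividedPartial K β) := by
        rw [mulMonomial, ← smul_mul_assoc, ← map_smul, MvPolynomial.smul_monomial, smul_eq_mul,
          mul_one]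
      rw [this]
      exact Submodule.smul_mem _ _ (Submodule.subset_span ⟨α, β, rfl⟩)
    | add a b ha hb => rw [map_add, add_mul]; exact add_mem ha hb
  have hterm : ∀ (g : Module.End K (MvPolynomial (Fin n) K)) (m : ℕ),
      ∑ β ∈ Finset.finsuppAntidiag Finset.univ m, Algebra.lmul K (MvPolynomial (Fin n) K)
        (g (MvPolynomial.monomial β 1)) * dividedPartial K β ∈ S ⊓ diffOpOrder K _ m := by
    intro g m
    refine sum_mem fun β hβ => ⟨hmem _ _, ?_⟩
    exact diffOpOrder_mul_aux m 0 m (zero_add m) _ _ (lmul_mem_diffOpOrder_zero _)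
      (dividedPartial_mem_diffOpOrder p (mem_finsuppAntidiag_univ.1 hβ).le)
  have heval : ∀ (g : Module.End K (MvPolynomial (Fin n) K)) (m : ℕ) (γ : Fin n →₀ ℕ),
      γ.degree ≤ m → (∑ β ∈ Finset.finsuppAntidiag Finset.univ m,
        Algebra.lmul K (MvPolynomial (Fin n) K)
        (g (MvPolynomial.monomial β 1)) * dividedPartial K β) (MvPolynomial.monomial γ 1)
      = if γ.degree = m then g (MvPolynomial.monomial γ 1) else 0 := by
    intro g m γ hγ
    rw [LinearMap.sum_apply]
    have hne : ∀ β : Fin n →₀ ℕ, β.degree = m → β ≠ γ → dividedPartial K β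
        (MvPolynomial.monomial γ (1 : K)) = 0 := by
      intro β hβ hne
      rw [dividedPartial_monomial, prod_choose_eq_zero, mul_zero, map_zero]
      intro hle
      obtain ⟨δ, rfl⟩ := exists_add_of_le hle
      rw [map_add] at hγ
      have : δ = 0 := (Finsupp.degree_eq_zero_iff δ).1 (by omega)
      exact hne (by simp [this])
    split_ifs with h
    · rw [Finset.sum_eq_single γ]
      · rw [Module.End.mul_apply, dividedPartial_monomial]
        simp only [tsub_self, Nat.choose_self, Nat.cast_one, Finset.prod_const_one, mul_one]
        change _ * (1 : MvPolynomial (Fin n) K) = _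
        rw [mul_one]
      · intro β hβ hβγ
        rw [Module.End.mul_apply, hne β (mem_finsuppAntidiag_univ.1 hβ) hβγ, map_zero]
      · intro h'
        exact absurd (mem_finsuppAntidiag_univ.2 h) h'
    · refine Finset.sum_eq_zero fun β hβ => ?_
      have hβ' := mem_finsuppAntidiag_univ.1 hβ
      rw [Module.End.mul_apply, hne β hβ' (by rintro rfl; exact h hβ'), map_zero]
  induction m with
  | zero =>
    refine ⟨_, (hterm f 0).1, (hterm f 0).2, fun γ hγ => ?_⟩
    rw [heval f 0 γ hγ, if_pos (by omega)]
  | succ m ih =>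
    obtain ⟨g, hg, hg2, h⟩ := ih
    refine ⟨_, add_mem hg (hterm (f - g) (m + 1)).1,
      add_mem (diffOpOrder_le_succ m hg2) (hterm (f - g) (m + 1)).2, fun γ hγ => ?_⟩
    rw [LinearMap.add_apply, heval (f - g) (m + 1) γ hγ]
    split_ifs with h'
    · rw [LinearMap.sub_apply]; abel
    · rw [add_zero, h γ (by omega)]

theorem mem_span_of_mem_diffOp (p : ℕ) [Fact p.Prime] [CharP K p]
    {f : Module.End K (MvPolynomial (Fin n) K)} (hf : f ∈ diffOp K (MvPolynomial (Fin n) K)) :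
    f ∈ Submodule.span K {f : Module.End K (MvPolynomial (Fin n) K) |
        ∃ α β : Fin n →₀ ℕ, f = mulMonomial K α * dividedPartial K β} := by
  obtain ⟨j, hj⟩ := hf
  obtain ⟨g, hg, hg2, h⟩ := exists_combination_dividedPartial p f j
  have : g - f = 0 := eq_zero_of_mem_diffOpOrder (Submodule.sub_mem _ hg2 hj) fun γ hγ => by
    rw [LinearMap.sub_apply, h γ hγ, sub_self]
  rwa [← sub_eq_zero.1 this]

end Generation

/-! ## Spans of the operators `x^α ∂^[β]` inside `𝒟(P_n)` -/

section OpSpan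

variable {K : Type*} [Field K] {n : ℕ}

/-- The ring structure of `𝒟(P_n)`, with the semiring structure of the subalgebra as a syntactic
component. -/
noncomputable instance (priority := 5000) polyDiffOpRing : Ring (PolyDiffOp K n) :=
  Algebra.semiringToRing K

variable (K) in
/-- Multiplication by `x^α` as an element of `𝒟(P_n)`. -/
noncomputable def mon (α : Fin n →₀ ℕ) : PolyDiffOp K n :=
  ⟨mulMonomial K α, 0, lmul_mem_diffOpOrder_zero _⟩

theorem mon_add (α α' : Fin n →₀ ℕ) : mon K (α + α') = mon K α * mon K α' :=
  Subtype.ext (mulMonomial_add α α')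

theorem mon_zero : mon K (0 : Fin n →₀ ℕ) = 1 := Subtype.ext mulMonomial_zero

theorem mon_comm (α α' : Fin n →₀ ℕ) : mon K α * mon K α' = mon K α' * mon K α := by
  rw [← mon_add, ← mon_add, add_comm]

variable (p : ℕ) [Fact p.Prime] [CharP K p]

variable (K) in
/-- `∂^[β]` as an element of `𝒟(P_n)`. -/
noncomputable def dp (β : Fin n →₀ ℕ) : PolyDiffOp K n :=
  ⟨dividedPartial K β, β.degree, dividedPartial_mem_diffOpOrder p le_rfl⟩

theorem dp_zero : dp K p (0 : Fin n →₀ ℕ) = 1 := Subtype.ext dividedPartial_zero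

theorem dp_mul_dp (β γ : Fin n →₀ ℕ) :
    dp K p β * dp K p γ = (∏ i, ((β i + γ i).choose (β i) : K)) • dp K p (β + γ) :=
  Subtype.ext (dividedPartial_mul β γ)

theorem dp_mul_mon_pow (k : ℕ) (β : Fin n →₀ ℕ) (i : Fin n) :
    dp K p β * mon K (Finsupp.single i (p ^ k))
      = mon K (Finsupp.single i (p ^ k)) * dp K p β
        + if Finsupp.single i (p ^ k) ≤ β then dp K p (β - Finsupp.single i (p ^ k)) else 0 := by
  refine Subtype.ext ((dividedPartial_mul_mulMonomial_pow p k β i).trans ?_)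
  split_ifs <;> rfl

theorem dp_mul_mon_single (β : Fin n →₀ ℕ) (i : Fin n) :
    dp K p β * mon K (Finsupp.single i 1)
      = mon K (Finsupp.single i 1) * dp K p β
        + if Finsupp.single i 1 ≤ β then dp K p (β - Finsupp.single i 1) else 0 := by
  simpa using dp_mul_mon_pow (K := K) p 0 β i

variable (K) in
/-- The span of the `x^α ∂^[β]` with `β ∈ L` and `|α| + |β| ≤ j`. -/
noncomputable def opSpan (L : Set (Fin n →₀ ℕ)) (j : ℕ) : Submodule K (PolyDiffOp K n) :=
  Submodule.span K {d | ∃ α β : Fin n →₀ ℕ, β ∈ L ∧ α.degree + β.degree ≤ j ∧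
    d = mon K α * dp K p β}

theorem canonicalFiltration_eq (j : ℕ) : canonicalFiltration K n j = opSpan K p Set.univ j := by
  rw [canonicalFiltration, opSpan]
  rw [← Submodule.comap_map_eq_of_injective
    (f := (diffOp K (MvPolynomial (Fin n) K)).val.toLinearMap) Subtype.val_injective
    (Submodule.span K {d | ∃ α β : Fin n →₀ ℕ, β ∈ Set.univ ∧ α.degree + β.degree ≤ j ∧
      d = mon K α * dp K p β}), Submodule.map_span]
  congr 2
  ext f
  constructor
  · rintro ⟨α, β, h, rfl⟩
    exact ⟨_, ⟨α, β, trivial, h, rfl⟩, rfl⟩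
  · rintro ⟨_, ⟨α, β, -, h, rfl⟩, rfl⟩
    exact ⟨α, β, h, rfl⟩

variable {p} {L : Set (Fin n →₀ ℕ)}

theorem mon_mul_dp_mem {α β : Fin n →₀ ℕ} (hβ : β ∈ L) {j : ℕ} (h : α.degree + β.degree ≤ j) :
    mon K α * dp K p β ∈ opSpan K p L j :=
  Submodule.subset_span ⟨α, β, hβ, h, rfl⟩

theorem opSpan_mono {L' : Set (Fin n →₀ ℕ)} (hL : L ⊆ L') {i j : ℕ} (h : i ≤ j) :
    opSpan K p L i ≤ opSpan K p L' j := by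
  refine Submodule.span_mono ?_
  rintro _ ⟨α, β, hβ, h', rfl⟩
  exact ⟨α, β, hL hβ, h'.trans h, rfl⟩

theorem mon_mul_mem {j : ℕ} {d : PolyDiffOp K n} (hd : d ∈ opSpan K p L j) (α : Fin n →₀ ℕ) :
    mon K α * d ∈ opSpan K p L (α.degree + j) := by
  induction hd using Submodule.span_induction with
  | mem x hx =>
    obtain ⟨α', β, hβ, h, rfl⟩ := hx
    rw [← mul_assoc, ← mon_add]
    exact mon_mul_dp_mem hβ (by rw [map_add]; omega)
  | zero => rw [mul_zero]; exact zero_mem _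
  | add x y _ _ hx hy => rw [mul_add]; exact add_mem hx hy
  | smul c x _ hx => rw [mul_smul_comm]; exact Submodule.smul_mem _ _ hx

theorem exists_single_add {α : Fin n →₀ ℕ} {m : ℕ} (h : α.degree = m + 1) :
    ∃ i α', α = Finsupp.single i 1 + α' ∧ α'.degree = m := by
  have h0 : α ≠ 0 := by rintro rfl; simp at h
  obtain ⟨i, hi⟩ := Finsupp.ne_iff.1 h0
  have hle : Finsupp.single i 1 ≤ α := by
    rw [Finsupp.single_le_iff]; simp at hi; omega
  have := degree_tsub_single hle
  exact ⟨i, α - Finsupp.single i 1, (add_tsub_cancel_of_le hle).symm, by omega⟩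

/-- Moving an x_i across ∂^[β] costs a term in which β is smaller; this is why `L` has to be a lower
set. The correction has lower total degree, so the filtration is respected. -/
theorem dp_mul_mon_mem (hL : IsLowerSet L) {m : ℕ} : ∀ {α β : Fin n →₀ ℕ}, α.degree = m → β ∈ L →
    ∀ {j : ℕ}, α.degree + β.degree ≤ j → dp K p β * mon K α ∈ opSpan K p L j := by
  induction m with
  | zero =>
    intro α β hα hβ j h
    obtain rfl : α = 0 := (Finsupp.degree_eq_zero_iff α).1 hα
    have := mon_mul_dp_mem (K := K) (p := p) hβ h
    rw [mon_zero, one_mul] at this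
    rwa [mon_zero, mul_one]
  | succ m ih =>
    intro α β hα hβ j h
    obtain ⟨i, α, rfl, hα'⟩ := exists_single_add hα
    rw [hα] at h
    rw [mon_add, ← mul_assoc, dp_mul_mon_single, add_mul, mul_assoc]
    refine add_mem ?_ ?_
    · refine opSpan_mono subset_rfl ?_
        (mon_mul_mem (ih hα' hβ (j := j - 1) (by omega)) (Finsupp.single i 1))
      rw [Finsupp.degree_single]; omega
    · split_ifs with hi
      · have := degree_tsub_single hi
        exact ih hα' (hL tsub_le_self hβ) (by omega)
      · rw [zero_mul]; exact zero_mem _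

theorem opSpan_eq_span_dp_mul_mon (hL : IsLowerSet L) (j : ℕ) :
    opSpan K p L j = Submodule.span K {d | ∃ α β : Fin n →₀ ℕ, β ∈ L ∧ α.degree + β.degree ≤ j ∧
      d = dp K p β * mon K α} := by
  set R : ℕ → Submodule K (PolyDiffOp K n) := fun j => Submodule.span K
    {d | ∃ α β : Fin n →₀ ℕ, β ∈ L ∧ α.degree + β.degree ≤ j ∧ d = dp K p β * mon K α} with hR
  have hRX : ∀ (j : ℕ) (i : Fin n), ∀ d ∈ R j, d * mon K (Finsupp.single i 1) ∈ R (j + 1) := by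
    intro j i d hd
    induction hd using Submodule.span_induction with
    | mem x hx =>
      obtain ⟨α', β, hβ, h, rfl⟩ := hx
      rw [mul_assoc, ← mon_add]
      exact Submodule.subset_span
        ⟨_, _, hβ, by rw [map_add, Finsupp.degree_single]; omega, rfl⟩
    | zero => rw [zero_mul]; exact zero_mem _
    | add x y _ _ hx hy => rw [add_mul]; exact add_mem hx hy
    | smul c x _ hx => rw [smul_mul_assoc]; exact Submodule.smul_mem _ _ hx
  refine le_antisymm (Submodule.span_le.2 ?_) (Submodule.span_le.2 ?_)
  · rintro _ ⟨α, β, hβ, h, rfl⟩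
    change _ ∈ R j
    obtain ⟨m, hm⟩ : ∃ m, α.degree = m := ⟨_, rfl⟩
    induction m generalizing α β j with
    | zero =>
      obtain rfl : α = 0 := (Finsupp.degree_eq_zero_iff α).1 hm
      exact Submodule.subset_span ⟨0, β, hβ, h, by rw [mon_zero, one_mul, mul_one]⟩
    | succ m ih =>
      obtain ⟨i, α, rfl, hα'⟩ := exists_single_add hm
      rw [hm] at h
      -- The wanted x^α x_i ∂^[β] is the difference of x^α ∂^[β] x_i and x^α ∂^[β - e_i], both
      -- covered by the induction on |α|.
      have e := congrArg (mon K α * ·) (dp_mul_mon_single (K := K) p β i)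
      simp only [mul_add, ← mul_assoc] at e
      rw [add_comm, mon_add]
      have h1 := hRX (j - 1) i _ (ih (j - 1) α β hβ (by omega) hα')
      rw [show j - 1 + 1 = j by omega, e] at h1
      refine (Submodule.add_mem_iff_left _ ?_).1 h1
      split_ifs with hi
      · have := degree_tsub_single hi
        exact ih j α _ (hL tsub_le_self hβ) (by omega) hα'
      · rw [mul_zero]; exact zero_mem _
  · rintro _ ⟨α, β, hβ, h, rfl⟩
    exact dp_mul_mon_mem hL rfl hβ h

theorem mul_dp_mem {j : ℕ} {d : PolyDiffOp K n} (hd : d ∈ opSpan K p Set.univ j)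
    (β : Fin n →₀ ℕ) : d * dp K p β ∈ opSpan K p Set.univ (j + β.degree) := by
  induction hd using Submodule.span_induction with
  | mem x hx =>
    obtain ⟨α', β', hβ, h, rfl⟩ := hx
    rw [mul_assoc, dp_mul_dp, mul_smul_comm]
    exact Submodule.smul_mem _ _ (mon_mul_dp_mem (Set.mem_univ _) (by rw [map_add]; omega))
  | zero => rw [zero_mul]; exact zero_mem _
  | add x y _ _ hx hy => rw [add_mul]; exact add_mem hx hy
  | smul c x _ hx => rw [smul_mul_assoc]; exact Submodule.smul_mem _ _ hx

theorem mul_mem_opSpan {i j : ℕ} {a b : PolyDiffOp K n} (ha : a ∈ opSpan K p Set.univ i)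
    (hb : b ∈ opSpan K p Set.univ j) : a * b ∈ opSpan K p Set.univ (i + j) := by
  induction ha using Submodule.span_induction with
  | mem x hx =>
    obtain ⟨α, β, -, h, rfl⟩ := hx
    induction hb using Submodule.span_induction with
    | mem y hy =>
      obtain ⟨α', β', -, h', rfl⟩ := hy
      rw [show mon K α * dp K p β * (mon K α' * dp K p β')
        = mon K α * (dp K p β * mon K α' * dp K p β') by simp only [mul_assoc]]
      refine opSpan_mono subset_rfl ?_
        (mon_mul_mem (mul_dp_mem (dp_mul_mon_mem isLowerSet_univ rfl trivial le_rfl) β') α)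
      omega
    | zero => rw [mul_zero]; exact zero_mem _
    | add x y _ _ hx hy => rw [mul_add]; exact add_mem hx hy
    | smul c x _ hx => rw [mul_smul_comm]; exact Submodule.smul_mem _ _ hx
  | zero => rw [zero_mul]; exact zero_mem _
  | add x y _ _ hx hy => rw [add_mul]; exact add_mem hx hy
  | smul c x _ hx => rw [smul_mul_assoc]; exact Submodule.smul_mem _ _ hx

theorem exists_mem_opSpan (p : ℕ) [Fact p.Prime] [CharP K p] (d : PolyDiffOp K n) :
    ∃ j, d ∈ opSpan K p Set.univ j := by
  have h : d ∈ Submodule.span K {d : PolyDiffOp K n |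
      ∃ α β : Fin n →₀ ℕ, d = mon K α * dp K p β} := by
    rw [← Submodule.comap_map_eq_of_injective
      (f := (diffOp K (MvPolynomial (Fin n) K)).val.toLinearMap) Subtype.val_injective
      (Submodule.span K _), Submodule.map_span, Submodule.mem_comap]
    refine Submodule.span_mono ?_ (mem_span_of_mem_diffOp p d.2)
    rintro _ ⟨α, β, rfl⟩
    exact ⟨_, ⟨α, β, rfl⟩, rfl⟩
  induction h using Submodule.span_induction with
  | mem x hx =>
    obtain ⟨α, β, rfl⟩ := hx
    exact ⟨_, mon_mul_dp_mem (Set.mem_univ _) le_rfl⟩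
  | zero => exact ⟨0, zero_mem _⟩
  | add x y _ _ hx hy =>
    obtain ⟨i, hi⟩ := hx
    obtain ⟨j, hj⟩ := hy
    exact ⟨max i j, add_mem (opSpan_mono subset_rfl (le_max_left _ _) hi)
      (opSpan_mono subset_rfl (le_max_right _ _) hj)⟩
  | smul c x _ hx =>
    obtain ⟨i, hi⟩ := hx
    exact ⟨i, Submodule.smul_mem _ _ hi⟩

instance finite_opSpan (j : ℕ) : Module.Finite K (opSpan K p L j) := by
  have h : Set.Finite {d : PolyDiffOp K n | ∃ α β : Fin n →₀ ℕ, β ∈ L ∧ α.degree + β.degree ≤ j ∧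
      d = mon K α * dp K p β} := by
    refine (((Finsupp.finite_of_degree_le (σ := Fin n) j).prod
      (Finsupp.finite_of_degree_le (σ := Fin n) j)).image
        fun x => mon K x.1 * dp K p x.2).subset ?_
    rintro _ ⟨α, β, -, h, rfl⟩
    exact ⟨(α, β), ⟨by simp; omega, by simp; omega⟩, rfl⟩
  exact Module.Finite.span_of_finite K h

end OpSpan

/-! ## Free decompositions -/

section FreeDecomposition

variable {K A I : Type*} [Field K] [Ring A] [Algebra K A] (e : I → A)

/-- The sum of the `e i N` is direct, and each `e i` is injective on `N`. -/
def IsFreeOn {Y : Type*} [AddCommGroup Y] [Module K Y] [Module A Y] (N : Submodule K Y) : Prop :=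
  ∀ ρ : I →₀ Y, (∀ i, ρ i ∈ N) → ρ.sum (fun i y => e i • y) = 0 → ρ = 0

variable {e} {T : Subalgebra K A} {Y M : Type*} [AddCommGroup Y] [Module K Y] [Module A Y]
  [AddCommGroup M] [Module K M] [Module A M]

/-- A = ∑ e_i T, and R is stable under T, so A S is contained in ∑ e_i R. -/
theorem exists_decomposition
    (hT : ∀ a : A, a ∈ AddSubmonoid.closure {b | ∃ i, ∃ t ∈ T, b = e i * t})
    {R : Submodule K Y} (hR : ∀ t ∈ T, ∀ y ∈ R, t • y ∈ R) {S : Set Y} (hS : S ⊆ R) {z : Y}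
    (hz : z ∈ Submodule.span A S) :
    ∃ ρ : I →₀ Y, (∀ i, ρ i ∈ R) ∧ ρ.sum (fun i y => e i • y) = z := by
  classical
  set C := AddSubmonoid.closure {y : Y | ∃ i, ∃ r ∈ R, y = e i • r} with hC
  have h1 : ∀ a : A, ∀ y ∈ R, a • y ∈ C := by
    intro a y hy
    induction hT a using AddSubmonoid.closure_induction with
    | mem b hb =>
      obtain ⟨i, t, ht, rfl⟩ := hb
      rw [mul_smul]
      exact AddSubmonoid.subset_closure ⟨i, _, hR t ht y hy, rfl⟩
    | zero => rw [zero_smul]; exact zero_mem _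
    | add a b _ _ ha hb => rw [add_smul]; exact add_mem ha hb
  have h2 : z ∈ C := by
    induction hz using Submodule.span_induction with
    | mem y hy => simpa using h1 1 y (hS hy)
    | zero => exact zero_mem _
    | add x y _ _ hx hy => exact add_mem hx hy
    | smul a x hx' hx =>
      clear hx'
      induction hx using AddSubmonoid.closure_induction with
      | mem y hy =>
        obtain ⟨i, r, hr, rfl⟩ := hy
        rw [smul_smul]
        exact h1 _ _ hr
      | zero => rw [smul_zero]; exact zero_mem _
      | add x y _ _ hx hy => rw [smul_add]; exact add_mem hx hy
  clear hz
  induction h2 using AddSubmonoid.closure_induction with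
  | mem y hy =>
    obtain ⟨i, r, hr, rfl⟩ := hy
    refine ⟨Finsupp.single i r, fun j => ?_, Finsupp.sum_single_index (smul_zero _)⟩
    rw [Finsupp.single_apply]
    split_ifs
    · exact hr
    · exact zero_mem _
  | zero => exact ⟨0, fun _ => zero_mem _, Finsupp.sum_zero_index⟩
  | add x y _ _ hx hy =>
    obtain ⟨ρ, h, rfl⟩ := hx
    obtain ⟨σ, h', rfl⟩ := hy
    exact ⟨ρ + σ, fun i => add_mem (h i) (h' i),
      Finsupp.sum_add_index' (fun _ => smul_zero _) fun _ _ _ => smul_add _ _ _⟩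

omit [Algebra K A] in
theorem IsFreeOn.eq_of_sum_eq {N : Submodule K Y} (h : IsFreeOn e N) {ρ σ : I →₀ Y}
    (hρ : ∀ i, ρ i ∈ N) (hσ : ∀ i, σ i ∈ N)
    (heq : ρ.sum (fun i y => e i • y) = σ.sum fun i y => e i • y) : ρ = σ := by
  refine sub_eq_zero.1 (h (ρ - σ) (fun i => sub_mem (hρ i) (hσ i)) ?_)
  rw [Finsupp.sum_sub_index fun _ _ _ => smul_sub _ _ _, heq, sub_self]

/-- Freeness survives division by relations lying in N. Lift a vanishing sum to coefficients in N;
the lift lies in A S, hence in ∑ e_i (N ∩ ker π), and uniqueness of coefficients in N puts every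
lifted coefficient into ker π. -/
theorem IsFreeOn.of_surjective [IsScalarTower K A Y] [IsScalarTower K A M]
    (hT : ∀ a : A, a ∈ AddSubmonoid.closure {b | ∃ i, ∃ t ∈ T, b = e i * t})
    {N : Submodule K Y} (h : IsFreeOn e N) (hN : ∀ t ∈ T, ∀ y ∈ N, t • y ∈ N)
    (π : Y →ₗ[A] M) {S : Set Y} (hS : S ⊆ N) (hker : LinearMap.ker π = Submodule.span A S) :
    IsFreeOn e (N.map (π.restrictScalars K)) := by
  classical
  intro ρ hρ hsum
  -- The lift must send 0 to 0 so that lifting the coefficients preserves finite support.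
  have hlift : ∀ m : M, ∃ y : Y, (m = 0 → y = 0) ∧
      (m ∈ N.map (π.restrictScalars K) → y ∈ N ∧ π y = m) := by
    intro m
    by_cases hm : m = 0
    · exact ⟨0, fun _ => rfl, fun _ => ⟨zero_mem _, by rw [hm, map_zero]⟩⟩
    · by_cases hm' : m ∈ N.map (π.restrictScalars K)
      · obtain ⟨y, hy, hy'⟩ := hm'
        exact ⟨y, fun h0 => absurd h0 hm, fun _ => ⟨hy, hy'⟩⟩
      · exact ⟨0, fun _ => rfl, fun h0 => absurd h0 hm'⟩
  choose l hl0 hl using hlift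
  set τ : I →₀ Y := ρ.mapRange l (hl0 0 rfl) with hτ
  have hτN : ∀ i, τ i ∈ N := fun i => by
    rw [hτ, Finsupp.mapRange_apply]; exact (hl _ (hρ i)).1
  have hτπ : ∀ i, π (τ i) = ρ i := fun i => by
    rw [hτ, Finsupp.mapRange_apply]; exact (hl _ (hρ i)).2
  have hmem : τ.sum (fun i y => e i • y) ∈ LinearMap.ker π := by
    rw [LinearMap.mem_ker, ← hsum, hτ, Finsupp.sum_mapRange_index fun i => smul_zero _,
      Finsupp.sum, Finsupp.sum, map_sum]
    exact Finset.sum_congr rfl fun i _ => by rw [map_smul, (hl _ (hρ i)).2]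
  rw [hker] at hmem
  obtain ⟨σ, hσ, hσs⟩ := exists_decomposition hT
    (R := N ⊓ (LinearMap.ker π).restrictScalars K)
    (fun t ht y hy => ⟨hN t ht y hy.1, by
      have : π y = 0 := hy.2
      change π (t • y) = 0
      rw [map_smul, this, smul_zero]⟩)
    (fun s hs => ⟨hS hs, by
      change s ∈ LinearMap.ker π
      rw [hker]; exact Submodule.subset_span hs⟩) hmem
  have := h.eq_of_sum_eq hτN (fun i => (hσ i).1) hσs.symm
  ext i
  rw [← hτπ i, this]
  exact (hσ i).2

/-- An element z of N is its own expansion, with the single coefficient z at e_{i₀} = 1. Its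
expansion as an element of A S has coefficients in R, and the two agree. This bounds the
intersection of a left ideal with T. -/
theorem IsFreeOn.mem_of_mem_span
    (hT : ∀ a : A, a ∈ AddSubmonoid.closure {b | ∃ i, ∃ t ∈ T, b = e i * t})
    {N : Submodule K Y} (h : IsFreeOn e N) {i₀ : I} (hi₀ : e i₀ = 1)
    {R : Submodule K Y} (hR : ∀ t ∈ T, ∀ y ∈ R, t • y ∈ R) (hRN : R ≤ N) {S : Set Y} (hS : S ⊆ R)
    {z : Y} (hz : z ∈ Submodule.span A S) (hzN : z ∈ N) : z ∈ R := by
  classical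
  obtain ⟨σ, hσ, hσs⟩ := exists_decomposition hT hR hS hz
  have h1 : (Finsupp.single i₀ z).sum (fun i y => e i • y) = z := by
    refine (Finsupp.sum_single_index (h := fun i y => e i • y) (smul_zero _)).trans ?_
    rw [hi₀, one_smul]
  have h2 := h.eq_of_sum_eq (ρ := Finsupp.single i₀ z) (σ := σ)
    (fun i => by
      rw [Finsupp.single_apply]
      split_ifs
      · exact hzN
      · exact zero_mem _) (fun i => hRN (hσ i)) (h1.trans hσs.symm)
  rw [← Finsupp.single_eq_same (a := i₀) (b := z), h2]
  exact hσ i₀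

theorem IsFreeOn.pi {N : Submodule K A} (h : IsFreeOn e N) {ι : Type*} :
    IsFreeOn e (Submodule.pi Set.univ fun _ : ι => N) := by
  intro ρ hρ hsum
  ext i j
  have h1 := h (ρ.mapRange (fun y : ι → A => y j) rfl)
    (fun i => by rw [Finsupp.mapRange_apply]; exact hρ i j (Set.mem_univ j))
    (by
      rw [Finsupp.sum_mapRange_index fun i => smul_zero _]
      have := congrFun hsum j
      rwa [Finsupp.sum, Finset.sum_apply] at this)
  simpa using DFunLike.congr_fun h1 i

/-! ### Freeness over a centralizer -/

variable {n q : ℕ} {x : Fin n → A} {f : (Fin n →₀ ℕ) → A}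

/-- Iterated commutators with the `x i` detect the coefficients of a combination of the `f β`. -/
theorem exists_iterated_commutator
    (hf : ∀ β i, f β * x i = x i * f β
      + if Finsupp.single i q ≤ β then f (β - Finsupp.single i q) else 0) (γ : Fin n →₀ ℕ) :
    ∃ Δ : A →+ A, ∀ β, ∀ t ∈ Subalgebra.centralizer K (Set.range x),
      Δ (f β * t) = if q • γ ≤ β then f (β - q • γ) * t else 0 := by
  induction γ using Finsupp.induction_linear with
  | zero => exact ⟨AddMonoidHom.id A, fun β t _ => by simp⟩
  | add γ γ' h h' =>
    obtain ⟨Δ, hΔ⟩ := h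
    obtain ⟨Δ', hΔ'⟩ := h'
    refine ⟨Δ.comp Δ', fun β t ht => ?_⟩
    have key : q • (γ + γ') ≤ β ↔ q • γ' ≤ β ∧ q • γ ≤ β - q • γ' := by
      rw [smul_add]
      constructor
      · intro h
        have h1 : q • γ' ≤ β := (le_add_self).trans h
        exact ⟨h1, (le_tsub_iff_right h1).2 h⟩
      · rintro ⟨h1, h2⟩
        exact (le_tsub_iff_right h1).1 h2
    rw [AddMonoidHom.comp_apply, hΔ' β t ht]
    by_cases h1 : q • γ' ≤ β
    · rw [if_pos h1, hΔ _ t ht, tsub_tsub, ← smul_add, add_comm γ' γ]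
      simp only [key, h1, true_and]
    · rw [if_neg h1, map_zero, if_neg (fun h => h1 (key.1 h).1)]
  | single i m =>
    induction m with
    | zero => exact ⟨AddMonoidHom.id A, fun β t _ => by simp⟩
    | succ m ih =>
      obtain ⟨Δ, hΔ⟩ := ih
      refine ⟨(AddMonoidHom.mulRight (x i) - AddMonoidHom.mulLeft (x i)).comp Δ,
        fun β t ht => ?_⟩
      have htx : t * x i = x i * t :=
        ((Subalgebra.mem_centralizer_iff K).1 ht (x i) ⟨i, rfl⟩).symm
      have hs : q • Finsupp.single i (m + 1) = q • Finsupp.single i m + Finsupp.single i q := by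
        rw [Finsupp.single_add, smul_add, Finsupp.smul_single q i 1]; simp
      have key : q • Finsupp.single i (m + 1) ≤ β ↔ q • Finsupp.single i m ≤ β ∧
          Finsupp.single i q ≤ β - q • Finsupp.single i m := by
        rw [hs]
        constructor
        · intro h
          have h1 : q • Finsupp.single i m ≤ β := (le_self_add).trans h
          exact ⟨h1, (le_tsub_iff_left h1).2 h⟩
        · rintro ⟨h1, h2⟩
          exact (le_tsub_iff_left h1).1 h2
      rw [AddMonoidHom.comp_apply, hΔ β t ht]
      by_cases h1 : q • Finsupp.single i m ≤ β
      · rw [if_pos h1, AddMonoidHom.sub_apply, AddMonoidHom.mulRight_apply,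
          AddMonoidHom.coe_mulLeft, mul_assoc, htx, ← mul_assoc, hf, add_mul, mul_assoc,
          add_sub_cancel_left]
        simp only [key, h1, true_and]
        rw [hs, ← tsub_tsub]
        split_ifs <;> simp
      · rw [if_neg h1, map_zero, if_neg (fun h => h1 (key.1 h).1)]

/-- Take γ of maximal degree in the support. The iterated commutator attached to γ kills the term of
any β not above γ, and by maximality β ≥ γ forces β = γ; what is left is the coefficient at γ. -/
theorem isFreeOn_centralizer (h0 : f 0 = 1)
    (hf : ∀ β i, f β * x i = x i * f β
      + if Finsupp.single i q ≤ β then f (β - Finsupp.single i q) else 0) :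
    IsFreeOn (fun β : {β : Fin n →₀ ℕ // ∀ i, q ∣ β i} => f β)
      (Subalgebra.toSubmodule (Subalgebra.centralizer K (Set.range x))) := by
  classical
  intro ρ hρ hsum
  by_contra hne
  obtain ⟨γ, hγ, hmax⟩ := Finset.exists_max_image ρ.support (fun β => β.1.degree)
    (Finsupp.support_nonempty_iff.2 hne)
  choose c hc using γ.2
  have hc' : γ.1 = q • Finsupp.equivFunOnFinite.symm c := by
    ext i; simpa using hc i
  obtain ⟨Δ, hΔ⟩ := exists_iterated_commutator (K := K) hf (Finsupp.equivFunOnFinite.symm c)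
  rw [← hc'] at hΔ
  have h1 := congrArg Δ hsum
  rw [Finsupp.sum, map_sum, map_zero, Finset.sum_eq_single γ] at h1
  · rw [smul_eq_mul, hΔ _ _ (hρ γ), if_pos le_rfl, tsub_self, h0, one_mul] at h1
    exact (Finsupp.mem_support_iff.1 hγ) h1
  · intro β hβ hβγ
    rw [smul_eq_mul, hΔ _ _ (hρ β), if_neg]
    intro hle
    obtain ⟨δ, hδ⟩ := exists_add_of_le hle
    have h2 := hmax β hβ
    rw [hδ, map_add] at h2
    have : δ = 0 := (Finsupp.degree_eq_zero_iff δ).1 (by omega)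
    exact hβγ (Subtype.ext (by rw [hδ, this, add_zero]))
  · exact fun h => absurd hγ h

end FreeDecomposition

/-! ## The subspaces `V M₀` -/

section SubspaceSMul

variable {K A M : Type*} [Field K] [Semiring A] [Algebra K A] [AddCommGroup M] [Module K M]
  [Module A M]

theorem smul_mem_subspaceSMul {V : Submodule K A} {M₀ : Submodule K M} {a : A} {x : M}
    (ha : a ∈ V) (hx : x ∈ M₀) : a • x ∈ subspaceSMul V M₀ :=
  Submodule.subset_span ⟨a, ha, x, hx, rfl⟩

theorem subspaceSMul_le {V : Submodule K A} {M₀ W : Submodule K M} :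
    subspaceSMul V M₀ ≤ W ↔ ∀ a ∈ V, ∀ x ∈ M₀, a • x ∈ W := by
  rw [subspaceSMul, Submodule.span_le]
  constructor
  · exact fun h a ha x hx => h ⟨a, ha, x, hx, rfl⟩
  · rintro h _ ⟨a, ha, x, hx, rfl⟩
    exact h a ha x hx

theorem subspaceSMul_mono {V V' : Submodule K A} {M₀ M₁ : Submodule K M} (h : V ≤ V')
    (h' : M₀ ≤ M₁) : subspaceSMul V M₀ ≤ subspaceSMul V' M₁ :=
  subspaceSMul_le.2 fun _ ha _ hx => smul_mem_subspaceSMul (h ha) (h' hx)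

variable [IsScalarTower K A M]

theorem subspaceSMul_span_le {G : Set A} {M₀ W : Submodule K M} :
    subspaceSMul (Submodule.span K G) M₀ ≤ W ↔ ∀ a ∈ G, ∀ x ∈ M₀, a • x ∈ W := by
  rw [subspaceSMul_le]
  refine ⟨fun h a ha => h a (Submodule.subset_span ha), fun h a ha x hx => ?_⟩
  induction ha using Submodule.span_induction with
  | mem a ha => exact h a ha x hx
  | zero => rw [zero_smul]; exact zero_mem _
  | add a b _ _ ha hb => rw [add_smul]; exact add_mem ha hb
  | smul c a _ ha => rw [smul_assoc]; exact Submodule.smul_mem _ _ ha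

theorem finite_subspaceSMul (V : Submodule K A) (M₀ : Submodule K M) [Module.Finite K V]
    [Module.Finite K M₀] : Module.Finite K (subspaceSMul V M₀) := by
  have : SMulCommClass A K M := IsScalarTower.to_smulCommClass'
  have h : subspaceSMul V M₀ = Submodule.map₂ (Algebra.lsmul K K M).toLinearMap V M₀ := by
    rw [Submodule.map₂_eq_span_image2, subspaceSMul]
    congr 1
    ext m
    constructor
    · rintro ⟨a, ha, x, hx, rfl⟩
      exact ⟨a, ha, x, hx, rfl⟩
    · rintro ⟨a, ha, x, hx, rfl⟩
      exact ⟨a, ha, x, hx, rfl⟩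
  rw [h]
  exact Module.Finite.iff_fg.2 ((Module.Finite.iff_fg.1 ‹_›).map₂ _ (Module.Finite.iff_fg.1 ‹_›))

end SubspaceSMul

/-! ## `𝒟(P_n)` over the centralizer of the `x_i^q` -/

section FrobeniusCentralizer

variable {K : Type*} [Field K] {n : ℕ}

/-- The exponents all of whose coordinates are less than `q`. -/
def expBox (n q : ℕ) : Set (Fin n →₀ ℕ) := {r | ∀ i, r i < q}

theorem isLowerSet_expBox (q : ℕ) : IsLowerSet (expBox n q) :=
  fun _ _ h hr i => (h i).trans_lt (hr i)

/-- The exponents all of whose coordinates are divisible by `q`. -/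
abbrev DivExp (n q : ℕ) : Type := {β : Fin n →₀ ℕ // ∀ i, q ∣ β i}

variable (K n) in
/-- The centralizer in `𝒟(P_n)` of the `x_i^q`. -/
noncomputable def frobeniusCentralizer (q : ℕ) : Subalgebra K (PolyDiffOp K n) :=
  Subalgebra.centralizer K (Set.range fun i => mon K (Finsupp.single i q))

theorem mon_mem_frobeniusCentralizer (q : ℕ) (α : Fin n →₀ ℕ) :
    mon K α ∈ frobeniusCentralizer K n q := by
  refine (Subalgebra.mem_centralizer_iff K).2 ?_
  rintro _ ⟨i, rfl⟩
  exact mon_comm _ _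

variable (p : ℕ) [Fact p.Prime] [CharP K p] (k : ℕ)

theorem dp_mem_frobeniusCentralizer {r : Fin n →₀ ℕ} (hr : r ∈ expBox n (p ^ k)) :
    dp K p r ∈ frobeniusCentralizer K n (p ^ k) := by
  refine (Subalgebra.mem_centralizer_iff K).2 ?_
  rintro _ ⟨i, rfl⟩
  have h : ¬ Finsupp.single i (p ^ k) ≤ r := by
    rw [Finsupp.single_le_iff, not_le]
    exact hr i
  rw [dp_mul_mon_pow, if_neg h, add_zero]

theorem opSpan_expBox_le (j : ℕ) : opSpan K p (expBox n (p ^ k)) j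
    ≤ Subalgebra.toSubmodule (frobeniusCentralizer K n (p ^ k)) := by
  refine Submodule.span_le.2 ?_
  rintro _ ⟨α, β, hβ, -, rfl⟩
  exact (frobeniusCentralizer K n (p ^ k)).mul_mem (mon_mem_frobeniusCentralizer _ α)
    (dp_mem_frobeniusCentralizer p k hβ)

variable (K) in
theorem isFreeOn_dp : IsFreeOn (fun β : DivExp n (p ^ k) => dp K p β.1)
    (Subalgebra.toSubmodule (frobeniusCentralizer K n (p ^ k))) :=
  isFreeOn_centralizer (f := dp K p) (x := fun i => mon K (Finsupp.single i (p ^ k))) (dp_zero p)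
    fun β i => dp_mul_mon_pow p k β i

/-- Splitting an exponent into a part divisible by `q` and a remainder. -/
theorem exists_dp_eq_mul (γ : Fin n →₀ ℕ) : ∃ β : DivExp n (p ^ k), ∃ r ∈ expBox n (p ^ k),
    γ = β.1 + r ∧ dp K p γ = dp K p β.1 * dp K p r := by
  have hq : 0 < p ^ k := pow_pos (Fact.out : p.Prime).pos k
  set r : Fin n →₀ ℕ := γ.mapRange (· % p ^ k) (Nat.zero_mod _) with hr
  have hrγ : r ≤ γ := fun i => Nat.mod_le _ _
  have hri : ∀ i, r i = γ i % p ^ k := fun i => rfl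
  have hbox : r ∈ expBox n (p ^ k) := fun i => Nat.mod_lt _ hq
  have hdvd : ∀ i, p ^ k ∣ (γ - r) i := fun i => Nat.dvd_sub_mod (γ i)
  refine ⟨⟨γ - r, hdvd⟩, r, hbox, (tsub_add_cancel_of_le hrγ).symm, ?_⟩
  rw [dp_mul_dp, tsub_add_cancel_of_le hrγ]
  -- No carry occurs: C(qc + r, r) ≡ C(r, r) = 1 for r < q.
  have : ∏ i, (((γ - r) i + r i).choose ((γ - r) i) : K) = 1 := by
    refine Finset.prod_eq_one fun i _ => ?_
    obtain ⟨c, hc⟩ := hdvd i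
    rw [Nat.choose_symm_add, hc, cast_choose_of_lt p k (hbox i), Nat.choose_self, Nat.cast_one]
  rw [this, one_smul]

/-- With derivatives written to the left, ∂^[β + r] x^α = ∂^[β] (∂^[r] x^α) has its second factor in
the centralizer. An additive closure is enough, as scalars are absorbed there too. -/
theorem mem_closure_dp_mul (d : PolyDiffOp K n) :
    d ∈ AddSubmonoid.closure {b : PolyDiffOp K n | ∃ β : DivExp n (p ^ k),
      ∃ t ∈ frobeniusCentralizer K n (p ^ k), b = dp K p β.1 * t} := by
  set C := AddSubmonoid.closure {b : PolyDiffOp K n | ∃ β : DivExp n (p ^ k),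
      ∃ t ∈ frobeniusCentralizer K n (p ^ k), b = dp K p β.1 * t} with hC
  have hsmul : ∀ (c : K), ∀ b ∈ C, c • b ∈ C := by
    intro c b hb
    induction hb using AddSubmonoid.closure_induction with
    | mem b hb =>
      obtain ⟨β, t, ht, rfl⟩ := hb
      exact AddSubmonoid.subset_closure ⟨β, c • t, Subalgebra.smul_mem _ ht c,
        (mul_smul_comm _ _ _).symm⟩
    | zero => rw [smul_zero]; exact zero_mem _
    | add x y _ _ hx hy => rw [smul_add]; exact add_mem hx hy
  obtain ⟨j, hj⟩ := exists_mem_opSpan p d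
  rw [opSpan_eq_span_dp_mul_mon isLowerSet_univ] at hj
  induction hj using Submodule.span_induction with
  | mem x hx =>
    obtain ⟨α, γ, -, -, rfl⟩ := hx
    obtain ⟨β, r, hr, -, h⟩ := exists_dp_eq_mul (K := K) p k γ
    rw [h, mul_assoc]
    exact AddSubmonoid.subset_closure ⟨β, _, mul_mem (dp_mem_frobeniusCentralizer p k hr)
      (mon_mem_frobeniusCentralizer _ α), rfl⟩
  | zero => exact zero_mem _
  | add x y _ _ hx hy => exact add_mem hx hy
  | smul c x _ hx => exact hsmul c x hx

/-- If |β| < q then every β_i < q. So any finite set of operators lies in the centralizer for large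
k, which is how finite presentation enters. -/
theorem mem_frobeniusCentralizer_of_lt {j : ℕ} {d : PolyDiffOp K n}
    (hd : d ∈ opSpan K p Set.univ j) (hj : j < p ^ k) :
    d ∈ frobeniusCentralizer K n (p ^ k) := by
  refine opSpan_expBox_le p k j (Submodule.span_mono ?_ hd)
  rintro _ ⟨α, β, -, h, rfl⟩
  refine ⟨α, β, fun i => ?_, h, rfl⟩
  have := Finsupp.le_degree i β
  omega

end FrobeniusCentralizer

/-! ## The Hilbert function of a module that is free over the centralizer -/

section Hilbert

variable {K : Type*} [Field K] {n : ℕ}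

/-- The exponents divisible by `q` of degree at most `i`. -/
noncomputable def divExpLE (n q i : ℕ) : Finset (DivExp n q) := by
  classical
  exact (Finsupp.finite_of_degree_le (σ := Fin n) i).toFinset.subtype _

theorem mem_divExpLE {q i : ℕ} {β : DivExp n q} : β ∈ divExpLE n q i ↔ β.1.degree ≤ i := by
  simp [divExpLE, Finset.mem_subtype]

variable (p : ℕ) [Fact p.Prime] [CharP K p] (k : ℕ) {M : Type*} [AddCommGroup M] [Module K M]
  [Module (PolyDiffOp K n) M] [IsScalarTower K (PolyDiffOp K n) M]

/-- F_i M₀ = ⨁ ∂^[β] V_{i - |β|}: freeness makes the sum direct and each ∂^[β] injective, while ∂^[β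
+ r] = ∂^[β] ∂^[r] adds degrees exactly, so the summands fill F_i M₀. -/
theorem finrank_subspaceSMul_opSpan {N M₀ : Submodule K M} [Module.Finite K M₀]
    (hfree : IsFreeOn (fun β : DivExp n (p ^ k) => dp K p β.1) N)
    (hN : ∀ t ∈ frobeniusCentralizer K n (p ^ k), ∀ x ∈ M₀, t • x ∈ N) (i : ℕ) :
    Module.finrank K (subspaceSMul (opSpan K p (Set.univ : Set (Fin n →₀ ℕ)) i) M₀)
      = ∑ β ∈ divExpLE n (p ^ k) i,
        Module.finrank K (subspaceSMul (opSpan K p (expBox n (p ^ k)) (i - β.1.degree)) M₀) := by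
  classical
  have hcomm : SMulCommClass (PolyDiffOp K n) K M := IsScalarTower.to_smulCommClass'
  set S := divExpLE n (p ^ k) i with hS
  set V : ℕ → Submodule K M := fun j => subspaceSMul (opSpan K p (expBox n (p ^ k)) j) M₀ with hV
  have hVN : ∀ j, V j ≤ N := fun j =>
    subspaceSMul_le.2 fun a ha x hx => hN a (opSpan_expBox_le p k j ha) x hx
  have hfin : ∀ j, Module.Finite K (V j) := fun j => finite_subspaceSMul _ _
  let Ψ : (∀ β : S, V (i - β.1.1.degree)) →ₗ[K] M :=
    ∑ β : S, ((Algebra.lsmul K K M (dp K p β.1.1)) ∘ₗ (V (i - β.1.1.degree)).subtype) ∘ₗ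
      LinearMap.proj β
  have hΨ : ∀ v, Ψ v = ∑ β : S, dp K p β.1.1 • (v β : M) := fun v => by simp [Ψ]
  have hinj : Function.Injective Ψ := by
    refine (injective_iff_map_eq_zero Ψ).2 fun v hv => ?_
    let g : DivExp n (p ^ k) → M := fun β => if h : β ∈ S then (v ⟨β, h⟩ : M) else 0
    let ρ : DivExp n (p ^ k) →₀ M := Finsupp.onFinset S g fun β hβ => by
      by_contra h
      exact hβ (dif_neg h)
    have hg : ∀ β : S, g β.1 = v β := fun β => dif_pos β.2
    have h0 : ρ = 0 := hfree ρ
      (fun β => by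
        change g β ∈ N
        by_cases h : β ∈ S
        · rw [hg ⟨β, h⟩]
          exact hVN _ (v ⟨β, h⟩).2
        · simp only [g, dif_neg h]
          exact zero_mem _)
      (by
        rw [Finsupp.onFinset_sum _ fun β => smul_zero _, ← Finset.sum_coe_sort]
        rw [hΨ] at hv
        simpa only [hg] using hv)
    funext β
    apply Subtype.ext
    rw [← hg β]
    exact DFunLike.congr_fun h0 β.1
  have hrange : LinearMap.range Ψ = subspaceSMul (opSpan K p (Set.univ : Set (Fin n →₀ ℕ)) i) M₀ := by
    apply le_antisymm
    · rintro _ ⟨v, rfl⟩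
      rw [hΨ]
      refine sum_mem fun β _ => ?_
      have hβ : β.1.1.degree ≤ i := mem_divExpLE.1 β.2
      have hle : V (i - β.1.1.degree) ≤ (subspaceSMul (opSpan K p (Set.univ : Set (Fin n →₀ ℕ)) i) M₀).comap
          (Algebra.lsmul K K M (dp K p β.1.1)) := by
        refine subspaceSMul_le.2 fun a ha x hx => ?_
        change dp K p β.1.1 • a • x ∈ subspaceSMul _ M₀
        rw [smul_smul]
        refine smul_mem_subspaceSMul ?_ hx
        have h1 : dp K p β.1.1 ∈ opSpan K p Set.univ β.1.1.degree := by
          rw [← one_mul (dp K p _), ← mon_zero]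
          exact mon_mul_dp_mem (Set.mem_univ _) (by simp)
        have := mul_mem_opSpan h1 (opSpan_mono (Set.subset_univ _) le_rfl ha)
        rwa [Nat.add_sub_cancel' hβ] at this
      exact hle (v β).2
    · rw [opSpan_eq_span_dp_mul_mon isLowerSet_univ]
      refine subspaceSMul_span_le.2 ?_
      rintro _ ⟨α, γ, -, h, rfl⟩ x hx
      obtain ⟨β, r, hr, hγ, hdp⟩ := exists_dp_eq_mul (K := K) p k γ
      have hdeg : γ.degree = β.1.degree + r.degree := by rw [hγ, map_add]
      have hβS : β ∈ S := mem_divExpLE.2 (by omega)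
      have hv : (dp K p r * mon K α) • x ∈ V (i - β.1.degree) :=
        smul_mem_subspaceSMul (dp_mul_mon_mem (isLowerSet_expBox _) rfl hr (by omega)) hx
      refine ⟨Pi.single ⟨β, hβS⟩ ⟨_, hv⟩, ?_⟩
      rw [hΨ, Finset.sum_eq_single ⟨β, hβS⟩]
      · rw [Pi.single_eq_same, smul_smul, ← mul_assoc, ← hdp]
      · intro b _ hb
        rw [Pi.single_eq_of_ne hb]
        simp
      · simp
  rw [← hrange, LinearMap.finrank_range_of_inj hinj, Module.finrank_pi_fintype,
    Finset.sum_coe_sort S fun β => Module.finrank K (V (i - β.1.degree))]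

end Hilbert

/-! ## Quasi-polynomials and power series -/

section QuasiPolynomial

theorem exists_discrete_antiderivative (d : ℕ) : ∀ R : ℚ[X], R.natDegree ≤ d →
    ∃ S : ℚ[X], S.natDegree ≤ d + 1 ∧ S.coeff (d + 1) = R.coeff d / (d + 1) ∧
      S.comp (X + 1) - S = R := by
  have key : ∀ (a : ℚ) (d : ℕ) (R : ℚ[X]), R.natDegree ≤ d → a = R.coeff d / (d + 1) → ∀ j, d ≤ j →
      (R - ((C a * X ^ (d + 1)).comp (X + 1) - C a * X ^ (d + 1))).coeff j = 0 := by
    intro a d R hR ha j hj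
    have hd : (d + 1 : ℚ) ≠ 0 := by positivity
    simp only [mul_comp, C_comp, pow_comp, X_comp, coeff_sub, coeff_C_mul, coeff_X_pow,
      Polynomial.coeff_X_add_one_pow]
    rcases Nat.eq_or_lt_of_le hj with rfl | hj
    · simp only [Nat.choose_succ_self_right, ha]
      rw [if_neg (by omega)]
      push_cast
      field_simp
      ring
    · rw [Polynomial.coeff_eq_zero_of_natDegree_lt (by omega)]
      rcases Nat.eq_or_lt_of_le hj with rfl | hj
      · simp
      · rw [Nat.choose_eq_zero_of_lt (by omega), if_neg (by omega)]; simp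
  induction d with
  | zero =>
    intro R hR
    refine ⟨C (R.coeff 0) * X ^ (0 + 1), natDegree_C_mul_X_pow_le _ _, by simp, ?_⟩
    symm
    rw [← sub_eq_zero]
    ext j
    rw [key (R.coeff 0) 0 R hR (by simp) j (Nat.zero_le j), coeff_zero]
  | succ d ih =>
    intro R hR
    set a := R.coeff (d + 1) / ((d + 1 : ℕ) + 1) with ha
    set T : ℚ[X] := C a * X ^ (d + 1 + 1) with hT
    obtain ⟨S, hS, -, hS'⟩ := ih (R - (T.comp (X + 1) - T))
      (natDegree_le_iff_coeff_eq_zero.2 fun j hj => key a (d + 1) R hR ha j hj)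
    refine ⟨S + T, ?_, ?_, ?_⟩
    · exact (natDegree_add_le _ _).trans
        (max_le (hS.trans (Nat.le_succ _)) (natDegree_C_mul_X_pow_le _ _))
    · rw [coeff_add, coeff_eq_zero_of_natDegree_lt (by omega), hT, coeff_C_mul, coeff_X_pow,
        if_pos rfl, ha]
      simp
    · rw [add_comp, add_sub_add_comm, hS']
      ring

/-- `f` agrees, for large arguments in each residue class modulo `q`, with a polynomial of degree
`d` and leading coefficient `c`. -/
def IsQuasiPolynomial (q : ℕ) (f : ℕ → ℚ) (d : ℕ) (c : ℚ) : Prop :=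
  ∀ r : ℕ, ∃ Q : ℚ[X], Q.natDegree = d ∧ Q.leadingCoeff = c ∧
    ∀ᶠ m : ℕ in atTop, f (r + q * m) = Q.eval ((r + q * m : ℕ) : ℚ)

theorem IsQuasiPolynomial.of_eventually {f : ℕ → ℚ} {q : ℕ} (hq : 0 < q) {Q : ℚ[X]}
    (h : ∀ᶠ i : ℕ in atTop, f i = Q.eval (i : ℚ)) :
    IsQuasiPolynomial q f Q.natDegree Q.leadingCoeff := fun r => by
  have ht : Tendsto (fun m => r + q * m) atTop atTop :=
    tendsto_atTop_mono (fun m => (Nat.le_mul_of_pos_left m hq).trans (Nat.le_add_left _ _)) tendsto_id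
  exact ⟨Q, rfl, rfl, ht.eventually h⟩

theorem IsQuasiPolynomial.of_one {f : ℕ → ℚ} {q d : ℕ} {c : ℚ} (hq : 0 < q)
    (h : IsQuasiPolynomial 1 f d c) : IsQuasiPolynomial q f d c := by
  obtain ⟨Q, rfl, rfl, hQ⟩ := h 0
  exact .of_eventually hq (by simpa using hQ)

theorem IsQuasiPolynomial.isAlmostPolynomial {f : ℕ → ℕ} {q d : ℕ} {c : ℚ} (hq : 0 < q)
    (h : IsQuasiPolynomial q (fun i => (f i : ℚ)) d c) : IsAlmostPolynomial f d c := by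
  have : NeZero q := ⟨hq.ne'⟩
  choose Q hQd hQc hQ using h
  refine ⟨q, hq, fun s => Q s.val, fun s => ⟨hQd _, hQc _⟩, ?_⟩
  have h1 : ∀ r, ∀ᶠ i : ℕ in atTop, i % q = r → (f i : ℚ) = (Q r).eval (i : ℚ) := by
    intro r
    obtain ⟨N, hN⟩ := eventually_atTop.1 (hQ r)
    refine eventually_atTop.2 ⟨r + q * N, fun i hi hir => ?_⟩
    have h2 := hN (i / q) ((Nat.le_div_iff_mul_le hq).2 (by
      have := Nat.mod_add_div i q
      nlinarith [Nat.mod_add_div i q, mul_comm N q]))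
    rw [← hir, Nat.mod_add_div i q] at h2
    rw [← hir]
    exact h2
  have h2 : ∀ᶠ i : ℕ in atTop, ∀ r ∈ Set.Iio q, i % q = r → (f i : ℚ) = (Q r).eval (i : ℚ) :=
    (eventually_all_finite (Set.finite_Iio q)).2 fun r _ => h1 r
  filter_upwards [h2] with i hi
  rw [ZMod.val_natCast]
  exact hi _ (Nat.mod_lt i hq) rfl

/-- Summation along steps of length `q` raises the degree by one. -/
theorem IsQuasiPolynomial.sum {f g : ℕ → ℚ} {q d : ℕ} {c : ℚ} (hq : 0 < q) (hc : c ≠ 0)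
    (h : IsQuasiPolynomial q f d c) (hg : ∀ i, g (i + q) = g i + f (i + q)) :
    IsQuasiPolynomial q g (d + 1) (c / (q * (d + 1))) := by
  intro r
  obtain ⟨R, hRd, hRc, hR⟩ := h r
  have hq' : (q : ℚ) ≠ 0 := by positivity
  have hd' : (d + 1 : ℚ) ≠ 0 := by positivity
  have hlin : ∀ a b : ℚ, a ≠ 0 → (C a * X + C b : ℚ[X]).natDegree = 1 := fun a b ha =>
    natDegree_linear ha
  have hlc : ∀ a b : ℚ, a ≠ 0 → (C a * X + C b : ℚ[X]).leadingCoeff = a := fun a b ha =>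
    leadingCoeff_linear ha
  -- With i = r + q m, this is R(i + q), the increment of g from m to m + 1, as a polynomial in m.
  set R1 : ℚ[X] := R.comp (C (q : ℚ) * X + C ((r : ℚ) + q)) with hR1
  have hR1d : R1.natDegree = d := by rw [hR1, natDegree_comp, hlin _ _ hq', hRd, mul_one]
  have hR1c : R1.coeff d = c * q ^ d := by
    have h1 : R1.leadingCoeff = c * q ^ d := by
      rw [hR1, leadingCoeff_comp (by rw [hlin _ _ hq']; exact one_ne_zero), hRc, hlc _ _ hq', hRd]
    rw [← h1, leadingCoeff, hR1d]
  obtain ⟨S, hSd, hSc, hS⟩ := exists_discrete_antiderivative d R1 hR1d.le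
  have hSeval : ∀ x : ℚ, S.eval (x + 1) = S.eval x + R1.eval x := by
    intro x
    rw [← hS]
    simp [eval_comp]
  obtain ⟨N, hN⟩ := eventually_atTop.1 hR
  have hu : ∀ m, N ≤ m → g (r + q * m) = S.eval (m : ℚ) + (g (r + q * N) - S.eval (N : ℚ)) := by
    intro m hm
    induction m, hm using Nat.le_induction with
    | base => ring
    | succ m hm ih =>
      rw [show r + q * (m + 1) = r + q * m + q by ring, hg, ih,
        show r + q * m + q = r + q * (m + 1) by ring, hN (m + 1) (by omega)]
      push_cast
      rw [hSeval, hR1, eval_comp]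
      simp only [eval_add, eval_mul, eval_C, eval_X]
      rw [show (r : ℚ) + q * (m + 1) = q * m + (r + q) by ring]
      ring
  set S1 : ℚ[X] := S + C (g (r + q * N) - S.eval (N : ℚ)) with hS1
  have hcoef : S1.coeff (d + 1) = c * q ^ d / (d + 1) := by
    rw [hS1, coeff_add, hSc, hR1c, coeff_C, if_neg (by omega), add_zero]
  have hS1d : S1.natDegree = d + 1 := by
    refine le_antisymm ((natDegree_add_le _ _).trans
      (max_le hSd ((natDegree_C _).le.trans (Nat.zero_le _)))) ?_
    refine le_natDegree_of_ne_zero ?_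
    rw [hcoef]
    positivity
  have hS1c : S1.leadingCoeff = c * q ^ d / (d + 1) := by rw [leadingCoeff, hS1d, hcoef]
  have hqi : (q : ℚ)⁻¹ ≠ 0 := inv_ne_zero hq'
  -- Substituting m = (i - r)/q returns to the variable i; the leading coefficient c q^d / (d + 1)
  -- is divided by q^(d+1).
  refine ⟨S1.comp (C (q : ℚ)⁻¹ * X + C (-(r : ℚ) / q)), ?_, ?_, ?_⟩
  · rw [natDegree_comp, hlin _ _ hqi, hS1d, mul_one]
  · rw [leadingCoeff_comp (by rw [hlin _ _ hqi]; exact one_ne_zero), hS1c, hlc _ _ hqi, hS1d, inv_pow,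
      pow_succ]
    field_simp
  · refine eventually_atTop.2 ⟨N, fun m hm => ?_⟩
    rw [hu m hm, eval_comp]
    simp only [eval_add, eval_mul, eval_C, eval_X, hS1]
    have : (q : ℚ)⁻¹ * ((r + q * m : ℕ) : ℚ) + -(r : ℚ) / q = m := by
      push_cast; field_simp; ring
    rw [this]

/-- The power series `1 / (1 - X^q)`. -/
noncomputable def geomSeries (q : ℕ) : PowerSeries ℚ := PowerSeries.mk fun i => if q ∣ i then 1 else 0

theorem geomSeries_eq {q : ℕ} (hq : 0 < q) :
    geomSeries q = 1 + PowerSeries.X ^ q * geomSeries q := by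
  ext i
  rw [map_add, PowerSeries.coeff_X_pow_mul', PowerSeries.coeff_one, geomSeries]
  simp only [PowerSeries.coeff_mk]
  by_cases h : q ≤ i
  · rw [if_neg (by omega : ¬ i = 0), if_pos h, zero_add]
    congr 1
    rw [eq_iff_iff]
    exact ⟨fun hd => Nat.dvd_sub hd dvd_rfl, fun hd => by
      have := Nat.dvd_add hd (dvd_refl q)
      rwa [Nat.sub_add_cancel h] at this⟩
  · rw [if_neg h, add_zero]
    congr 1
    rw [eq_iff_iff]
    exact ⟨fun hd => Nat.eq_zero_of_dvd_of_lt hd (by omega), fun hd => hd ▸ dvd_zero q⟩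

theorem IsQuasiPolynomial.mul_geomSeries {F : PowerSeries ℚ} {q d : ℕ} {c : ℚ} (hq : 0 < q)
    (hc : c ≠ 0) (h : IsQuasiPolynomial q (fun i => PowerSeries.coeff i F) d c) :
    IsQuasiPolynomial q (fun i => PowerSeries.coeff i (F * geomSeries q)) (d + 1)
      (c / (q * (d + 1))) := by
  refine h.sum hq hc fun i => ?_
  have e : F * geomSeries q = F + PowerSeries.X ^ q * (F * geomSeries q) := by
    conv_lhs => rw [geomSeries_eq hq]
    ring
  conv_lhs => rw [e]
  rw [map_add, PowerSeries.coeff_X_pow_mul, add_comm]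

/-- Each factor 1/(1 - X^q) is one summation in steps of q, and the divisors q (d + 1), …, q (d + m)
accumulate. -/
theorem IsQuasiPolynomial.mul_geomSeries_pow {F : PowerSeries ℚ} {q d : ℕ} {c : ℚ} (hq : 0 < q)
    (hc : c ≠ 0) (h : IsQuasiPolynomial q (fun i => PowerSeries.coeff i F) d c) (m : ℕ) :
    IsQuasiPolynomial q (fun i => PowerSeries.coeff i (F * geomSeries q ^ m)) (d + m)
      (c * d.factorial / (q ^ m * (d + m).factorial)) := by
  have hq' : (q : ℚ) ≠ 0 := by positivity
  have hf : ∀ m : ℕ, (m.factorial : ℚ) ≠ 0 := fun m => by positivity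
  induction m with
  | zero => simpa [hf] using h
  | succ m ih =>
    have h1 := ih.mul_geomSeries hq
      (div_ne_zero (mul_ne_zero hc (hf d)) (mul_ne_zero (pow_ne_zero _ hq') (hf _)))
    rw [mul_assoc, ← pow_succ] at h1
    convert h1 using 1
    · rfl
    have : ((d + m : ℕ) + 1 : ℚ) ≠ 0 := by positivity
    rw [← add_assoc, Nat.factorial_succ, pow_succ]
    push_cast at this ⊢
    have h2 := hf (d + m)
    field_simp

theorem isQuasiPolynomial_geomSeries_one :
    IsQuasiPolynomial 1 (fun i => PowerSeries.coeff i (geomSeries 1)) 0 1 := by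
  have := IsQuasiPolynomial.of_eventually (f := fun i => PowerSeries.coeff i (geomSeries 1))
    (Q := 1) one_pos (Eventually.of_forall fun i => by simp [geomSeries])
  simpa using this

/-- The polynomial `1 + X + ⋯ + X^(q-1)`. -/
noncomputable def truncGeomSeries (q : ℕ) : PowerSeries ℚ :=
  PowerSeries.mk fun i => if i < q then 1 else 0

theorem truncGeomSeries_mul {q : ℕ} (hq : 0 < q) :
    truncGeomSeries q * geomSeries q = geomSeries 1 := by
  have h1 : geomSeries 1 = truncGeomSeries q + PowerSeries.X ^ q * geomSeries 1 := by
    ext i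
    rw [map_add, PowerSeries.coeff_X_pow_mul', geomSeries, truncGeomSeries]
    simp only [PowerSeries.coeff_mk, isUnit_one, IsUnit.dvd, if_true]
    split_ifs <;> first | omega | simp
  have h2 := geomSeries_eq hq
  calc truncGeomSeries q * geomSeries q
      = (geomSeries 1 - PowerSeries.X ^ q * geomSeries 1) * geomSeries q := by
        rw [eq_sub_of_add_eq h1.symm]
    _ = geomSeries 1 * (geomSeries q - PowerSeries.X ^ q * geomSeries q) := by ring
    _ = geomSeries 1 := by rw [sub_eq_of_eq_add h2, mul_one]

/-- Expand the product and group the exponents γ by degree. It serves both for divisibility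
conditions (the summands ∂^[β] V) and for truncated exponents (the small modules). -/
theorem coeff_mul_prod_indicator {n : ℕ} (h : ℕ → ℚ) (A : Fin n → ℕ → Prop)
    [∀ x, DecidablePred (A x)] (i : ℕ) :
    PowerSeries.coeff i (PowerSeries.mk h * ∏ x, PowerSeries.mk fun j => if A x j then (1 : ℚ) else 0)
      = ∑ γ ∈ (Finsupp.finite_of_degree_le (σ := Fin n) i).toFinset with ∀ x, A x (γ x),
        h (i - γ.degree) := by
  classical
  rw [PowerSeries.coeff_mul, Finset.sum_filter, Finset.Nat.sum_antidiagonal_eq_sum_range_succ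
    (fun a b => PowerSeries.coeff a (PowerSeries.mk h) * PowerSeries.coeff b
      (∏ x, PowerSeries.mk fun j => if A x j then (1 : ℚ) else 0)),
    ← Finset.sum_range_reflect]
  rw [← Finset.sum_fiberwise_of_maps_to (s := (Finsupp.finite_of_degree_le i).toFinset)
    (t := Finset.range (i + 1)) (g := Finsupp.degree) (fun γ hγ => by
      simp at hγ ⊢; omega)]
  refine Finset.sum_congr rfl fun b hb => ?_
  have hb' : b ≤ i := by simpa [Nat.lt_succ_iff] using hb
  rw [show i + 1 - 1 - b = i - b by omega, Nat.sub_sub_self hb', PowerSeries.coeff_prod,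
    PowerSeries.coeff_mk, Finset.mul_sum]
  have e : (Finsupp.finite_of_degree_le (σ := Fin n) i).toFinset.filter (fun γ => γ.degree = b)
      = Finset.finsuppAntidiag Finset.univ b := by
    ext γ
    rw [mem_finsuppAntidiag_univ]
    simp
    omega
  rw [e]
  refine Finset.sum_congr rfl fun γ hγ => ?_
  rw [mem_finsuppAntidiag_univ.1 hγ]
  simp only [PowerSeries.coeff_mk]
  rw [Finset.prod_ite_zero]
  simp

theorem sum_divExpLE {n : ℕ} (h : ℕ → ℚ) (q i : ℕ) :
    ∑ β ∈ divExpLE n q i, h (i - β.1.degree)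
      = PowerSeries.coeff i (PowerSeries.mk h * geomSeries q ^ n) := by
  classical
  have h1 := coeff_mul_prod_indicator (n := n) h (fun _ j => q ∣ j) i
  rw [Finset.prod_const, Finset.card_univ, Fintype.card_fin] at h1
  rw [geomSeries, h1, divExpLE]
  exact Finset.sum_subtype_eq_sum_filter fun γ : Fin n →₀ ℕ => h (i - γ.degree)

end QuasiPolynomial

/-! ## Asymptotics -/

section Asymptotics

theorem IsAlmostPolynomial.tendsto {f : ℕ → ℕ} {d : ℕ} {c : ℚ} (hc : c ≠ 0)
    (h : IsAlmostPolynomial f d c) : Tendsto (fun i : ℕ => (f i : ℚ) / (i : ℚ) ^ d) atTop (nhds c) := by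
  obtain ⟨k, hk, q, hq, hf⟩ := h
  have : NeZero k := ⟨hk.ne'⟩
  have h1 : ∀ s, Tendsto (fun i : ℕ => (q s).eval (i : ℚ) / (i : ℚ) ^ d) atTop (nhds c) := by
    intro s
    have hs : q s ≠ 0 := by
      intro h0
      have := (hq s).2
      rw [h0, leadingCoeff_zero] at this
      exact hc this.symm
    have h2 := div_tendsto_atTop_leadingCoeff_div_of_degree_eq (q s) (X ^ d : ℚ[X])
      (by rw [degree_X_pow, degree_eq_natDegree hs, (hq s).1])
    rw [(hq s).2, leadingCoeff_X_pow, div_one] at h2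
    simpa [Function.comp_def] using h2.comp (tendsto_natCast_atTop_atTop (R := ℚ))
  intro U hU
  have h3 : ∀ᶠ i : ℕ in atTop, ∀ s, (q s).eval (i : ℚ) / (i : ℚ) ^ d ∈ U :=
    eventually_all.2 fun s => h1 s hU
  change ∀ᶠ i : ℕ in atTop, (f i : ℚ) / (i : ℚ) ^ d ∈ U
  filter_upwards [h3, hf] with i hi hfi
  rw [hfi]
  exact hi _

theorem IsAlmostPolynomial.not_le {f : ℕ → ℕ} {d n : ℕ} {c : ℚ} (hc : 0 < c) (hnd : n < d)
    (h : IsAlmostPolynomial f d c) {Q : ℚ[X]} (hQ : Q.natDegree ≤ n)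
    (hle : ∀ᶠ i : ℕ in atTop, (f i : ℚ) ≤ Q.eval (i : ℚ)) : False := by
  have h1 := h.tendsto hc.ne'
  have h2 := div_tendsto_atTop_zero_of_degree_lt Q (X ^ d : ℚ[X]) (by
    rw [degree_X_pow]
    exact degree_le_natDegree.trans_lt (by exact_mod_cast hQ.trans_lt hnd))
  have h3 := h2.comp (tendsto_natCast_atTop_atTop (R := ℚ))
  refine absurd (le_of_tendsto_of_tendsto h1 h3 ?_) (_root_.not_le.2 hc)
  filter_upwards [hle] with i hi
  simp only [Function.comp_apply, eval_pow, eval_X]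
  exact div_le_div_of_nonneg_right hi (by positivity)

/-- A shift of the argument is invisible in the leading coefficient because (i + a)/i → 1. Used in
both directions, this makes the multiplicity independent of M₀. -/
theorem IsAlmostPolynomial.leadingCoeff_le {f g : ℕ → ℕ} {n : ℕ} {c c' : ℚ} (hc : c ≠ 0)
    (hc' : c' ≠ 0) (hf : IsAlmostPolynomial f n c) (hg : IsAlmostPolynomial g n c') {a : ℕ}
    (hle : ∀ i, f i ≤ g (i + a)) : c ≤ c' := by
  have h1 := hf.tendsto hc
  have h2 := (hg.tendsto hc').comp (tendsto_add_atTop_nat a)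
  have h3 : Tendsto (fun i : ℕ => ((i + a : ℕ) : ℚ) / i) atTop (nhds 1) := by
    have h4 := div_tendsto_atTop_leadingCoeff_div_of_degree_eq (X + C (a : ℚ) : ℚ[X]) X
      (by rw [degree_X_add_C, degree_X])
    rw [leadingCoeff_X_add_C, leadingCoeff_X, div_one] at h4
    simpa [Function.comp_def] using h4.comp (tendsto_natCast_atTop_atTop (R := ℚ))
  have h5 := h2.mul (h3.pow n)
  rw [one_pow, mul_one] at h5
  refine le_of_tendsto_of_tendsto h1 h5 ?_
  filter_upwards [eventually_gt_atTop 0] with i hi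
  have hi' : (0 : ℚ) < i := by exact_mod_cast hi
  have hia : (0 : ℚ) < ((i + a : ℕ) : ℚ) := by positivity
  simp only [Function.comp_apply]
  rw [div_pow, div_mul_div_cancel₀ (pow_ne_zero _ hia.ne')]
  exact div_le_div_of_nonneg_right (by exact_mod_cast hle i) (by positivity)

end Asymptotics

/-! ## Holonomic modules -/

section Holonomic

theorem one_mem_opSpan {K : Type*} [Field K] {n p : ℕ} [Fact p.Prime] [CharP K p]
    {L : Set (Fin n →₀ ℕ)} (hL : 0 ∈ L) (j : ℕ) : (1 : PolyDiffOp K n) ∈ opSpan K p L j := by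
  have h := mon_mul_dp_mem (K := K) (p := p) (α := 0) hL (j := j) (by simp)
  rwa [mon_zero, dp_zero, one_mul] at h

variable {K : Type*} [Field K] {n : ℕ} {p : ℕ} [Fact p.Prime] [CharP K p]
  {M : Type*} [AddCommGroup M] [Module K M]
  [Module (PolyDiffOp K n) M] [IsScalarTower K (PolyDiffOp K n) M]

theorem subspaceSMul_opSpan_subspaceSMul_le {i j : ℕ} {M₀ : Submodule K M} :
    subspaceSMul (opSpan K p (Set.univ : Set (Fin n →₀ ℕ)) i)
      (subspaceSMul (opSpan K p (Set.univ : Set (Fin n →₀ ℕ)) j) M₀)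
    ≤ subspaceSMul (opSpan K p (Set.univ : Set (Fin n →₀ ℕ)) (i + j)) M₀ := by
  refine subspaceSMul_le.2 fun a ha x hx => ?_
  have hcomm : SMulCommClass (PolyDiffOp K n) K M := IsScalarTower.to_smulCommClass'
  have h : subspaceSMul (opSpan K p (Set.univ : Set (Fin n →₀ ℕ)) j) M₀
      ≤ (subspaceSMul (opSpan K p (Set.univ : Set (Fin n →₀ ℕ)) (i + j)) M₀).comap
        (Algebra.lsmul K K M a) := by
    refine subspaceSMul_le.2 fun b hb y hy => ?_
    change a • b • y ∈ subspaceSMul _ M₀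
    rw [smul_smul]
    exact smul_mem_subspaceSMul (mul_mem_opSpan ha hb) hy
  exact h hx

omit [IsScalarTower K (PolyDiffOp K n) M] in
theorem subspaceSMul_opSpan_mono {i j : ℕ} (h : i ≤ j) (M₀ : Submodule K M) :
    subspaceSMul (opSpan K p (Set.univ : Set (Fin n →₀ ℕ)) i) M₀
      ≤ subspaceSMul (opSpan K p (Set.univ : Set (Fin n →₀ ℕ)) j) M₀ :=
  subspaceSMul_mono (opSpan_mono subset_rfl h) le_rfl

variable (p) in
theorem exists_mem_subspaceSMul {M₀ : Submodule K M} {x : M}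
    (hx : x ∈ Submodule.span (PolyDiffOp K n) (M₀ : Set M)) :
    ∃ a, x ∈ subspaceSMul (opSpan K p (Set.univ : Set (Fin n →₀ ℕ)) a) M₀ := by
  induction hx using Submodule.span_induction with
  | mem x hx =>
    refine ⟨0, ?_⟩
    have h := smul_mem_subspaceSMul (one_mem_opSpan (K := K) (p := p)
      (Set.mem_univ (0 : Fin n →₀ ℕ)) 0) hx
    rwa [one_smul] at h
  | zero => exact ⟨0, zero_mem _⟩
  | add x y _ _ hx hy =>
    obtain ⟨a, ha⟩ := hx
    obtain ⟨b, hb⟩ := hy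
    exact ⟨max a b, add_mem (subspaceSMul_opSpan_mono (le_max_left _ _) _ ha)
      (subspaceSMul_opSpan_mono (le_max_right _ _) _ hb)⟩
  | smul d x _ hx =>
    obtain ⟨a, ha⟩ := hx
    obtain ⟨j, hj⟩ := exists_mem_opSpan p d
    exact ⟨j + a, subspaceSMul_opSpan_subspaceSMul_le (smul_mem_subspaceSMul hj ha)⟩

variable (p) in
theorem exists_le_subspaceSMul {M₀ M₁ : Submodule K M}
    (h₀ : IsGeneratingSubspace (PolyDiffOp K n) M₀) (h₁ : M₁.FG) :
    ∃ a, M₁ ≤ subspaceSMul (opSpan K p (Set.univ : Set (Fin n →₀ ℕ)) a) M₀ := by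
  have hx : ∀ x : M, ∃ a, x ∈ subspaceSMul (opSpan K p (Set.univ : Set (Fin n →₀ ℕ)) a) M₀ :=
    fun x => exists_mem_subspaceSMul p (h₀.2 ▸ Submodule.mem_top)
  choose a ha using hx
  obtain ⟨s, rfl⟩ := h₁
  refine ⟨s.sup a, Submodule.span_le.2 fun x hxs => ?_⟩
  exact subspaceSMul_opSpan_mono (Finset.le_sup hxs) _ (ha x)

/-- F_i M₁ ⊆ F_{i+a} M₀ ⊆ F'_{c(i+a)+d} M₀, and a linear substitution keeps the degree of the
bounding polynomial. So the bound passes to the canonical filtration and any finite dimensional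
subspace. -/
theorem IsHolonomic.exists_bound (h : IsHolonomic K n M) (p : ℕ) [Fact p.Prime] [CharP K p]
    (M₁ : Submodule K M) [Module.Finite K M₁] :
    ∃ Q : ℚ[X], Q.natDegree ≤ n ∧ ∀ᶠ i : ℕ in atTop, (Module.finrank K
      (subspaceSMul (opSpan K p (Set.univ : Set (Fin n →₀ ℕ)) i) M₁) : ℚ) ≤ Q.eval (i : ℚ) := by
  obtain ⟨F', ⟨hF', _, _, c, d, _, hc, hcd⟩, M₀, h₀, q, hq, hb⟩ := h
  obtain ⟨a, ha⟩ := exists_le_subspaceSMul p h₀ (Module.Finite.iff_fg.1 ‹Module.Finite K M₁›)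
  have hfin₀ : Module.Finite K M₀ := h₀.1
  have ht1 : Tendsto (fun i => i + a) atTop atTop := tendsto_add_atTop_nat a
  have ht2 : Tendsto (fun i => c * (i + a) + d) atTop atTop :=
    tendsto_atTop_mono (fun i => by
      have := Nat.le_mul_of_pos_left (i + a) hc
      simp only [id]
      omega) tendsto_id
  refine ⟨q.comp (C (c : ℚ) * X + C ((c * a + d : ℕ) : ℚ)), ?_, ?_⟩
  · rw [natDegree_comp, natDegree_linear (by positivity), mul_one]
    exact (natDegree_eq_of_degree_eq_some hq).le
  · filter_upwards [ht1.eventually hcd, ht2.eventually hb] with i h1 h2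
    have hfin := hF'.finiteDimensional (c * (i + a) + d)
    have := finite_subspaceSMul (F' (c * (i + a) + d)) M₀
    have h3 : subspaceSMul (opSpan K p (Set.univ : Set (Fin n →₀ ℕ)) i) M₁
        ≤ subspaceSMul (F' (c * (i + a) + d)) M₀ := by
      refine (subspaceSMul_mono le_rfl ha).trans (subspaceSMul_opSpan_subspaceSMul_le.trans ?_)
      rw [← canonicalFiltration_eq]
      exact subspaceSMul_mono h1.2 le_rfl
    have h4 : (Module.finrank K (subspaceSMul (opSpan K p (Set.univ : Set (Fin n →₀ ℕ)) i) M₁) : ℚ)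
        ≤ Module.finrank K (subspaceSMul (F' (c * (i + a) + d)) M₀) := by
      exact_mod_cast Submodule.finrank_mono h3
    refine (h4.trans h2).trans_eq ?_
    rw [eval_comp]
    congr 1
    simp
    ring

/-- Over a finitely presented module, the sum of the `∂^[β] N`, `β` divisible by a large power
of `p`, is direct for a subspace `N` containing `T M₀`. -/
theorem exists_isFreeOn (p : ℕ) [Fact p.Prime] [CharP K p]
    (hM : Module.FinitePresentation (PolyDiffOp K n) M) {M₀ : Submodule K M}
    (h₀ : IsGeneratingSubspace (PolyDiffOp K n) M₀) :
    ∃ k, ∃ N : Submodule K M, IsFreeOn (fun β : DivExp n (p ^ k) => dp K p β.1) N ∧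
      ∀ t ∈ frobeniusCentralizer K n (p ^ k), ∀ x ∈ M₀, t • x ∈ N := by
  classical
  obtain ⟨s, hs⟩ := Module.Finite.iff_fg.1 h₀.1
  set π : (s → PolyDiffOp K n) →ₗ[PolyDiffOp K n] M :=
    Fintype.linearCombination (PolyDiffOp K n) (fun x : s => (x : M)) with hπ
  have hsurj : Function.Surjective π := by
    rw [← LinearMap.range_eq_top, hπ, Fintype.range_linearCombination, ← h₀.2, ← hs]
    refine le_antisymm (Submodule.span_mono ?_) (Submodule.span_le.2 ?_)
    · rintro _ ⟨x, rfl⟩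
      exact Submodule.subset_span x.2
    · intro x hx
      change x ∈ (Submodule.span (PolyDiffOp K n) (Set.range fun x : s => (x : M))).restrictScalars K
      refine (Submodule.span_le.2 ?_ : Submodule.span K (s : Set M) ≤ _) hx
      intro y hy
      exact Submodule.subset_span ⟨⟨y, hy⟩, rfl⟩
  obtain ⟨S, hS⟩ := Module.FinitePresentation.fg_ker π hsurj
  choose j hj using fun d : PolyDiffOp K n => exists_mem_opSpan p d
  -- p^k exceeds the filtration degree of every entry of every relation, so the relations have
  -- entries in the centralizer.
  obtain ⟨k, hk⟩ : ∃ k, (S.sup fun v => Finset.univ.sup fun x => j (v x)) < p ^ k :=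
    ⟨_, Nat.lt_pow_self (Fact.out : p.Prime).one_lt⟩
  have hST : (S : Set (s → PolyDiffOp K n)) ⊆ Submodule.pi Set.univ fun _ : s =>
      Subalgebra.toSubmodule (frobeniusCentralizer K n (p ^ k)) := by
    intro v hv x _
    refine mem_frobeniusCentralizer_of_lt p k (hj (v x)) (lt_of_le_of_lt ?_ hk)
    exact (Finset.le_sup (f := fun x => j (v x)) (Finset.mem_univ x)).trans
      (Finset.le_sup (f := fun v : s → PolyDiffOp K n => Finset.univ.sup fun x => j (v x)) hv)
  refine ⟨k, _, IsFreeOn.of_surjective (mem_closure_dp_mul p k) ((isFreeOn_dp K p k).pi (ι := s))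
    (fun t ht y hy x hx => (frobeniusCentralizer K n (p ^ k)).mul_mem ht (hy x hx)) π hST hS.symm,
    fun t ht x hx => ?_⟩
  rw [← hs] at hx
  have hcomm : SMulCommClass (PolyDiffOp K n) K M := IsScalarTower.to_smulCommClass'
  induction hx using Submodule.span_induction with
  | mem x hx =>
    refine ⟨Pi.single ⟨x, hx⟩ t, fun y _ => ?_, ?_⟩
    · by_cases hy : y = ⟨x, hx⟩
      · subst hy; rw [Pi.single_eq_same]; exact ht
      · rw [Pi.single_eq_of_ne hy]; exact zero_mem _
    · change π _ = _
      rw [hπ, Fintype.linearCombination_apply_single]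
  | zero => rw [smul_zero]; exact zero_mem _
  | add x y _ _ hx hy => rw [smul_add]; exact add_mem hx hy
  | smul c x _ hx => rw [smul_comm]; exact Submodule.smul_mem _ _ hx

/-- The operators preserving V form a subalgebra containing the generators of T_k, hence also its
matrix units, which then act on V. -/
theorem pow_dvd_finrank_of_stable (k : ℕ) {V : Submodule K M} [Module.Finite K V]
    (hX : ∀ i, ∀ v ∈ V, mon K (Finsupp.single i 1 : Fin n →₀ ℕ) • v ∈ V)
    (hdp : ∀ r ∈ expBox n (p ^ k), ∀ v ∈ V, dp K p r • v ∈ V) :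
    (p ^ k) ^ n ∣ Module.finrank K V := by
  have hcomm : SMulCommClass (PolyDiffOp K n) K M := IsScalarTower.to_smulCommClass'
  let S : Subalgebra K (PolyDiffOp K n) :=
    { carrier := {d | ∀ v ∈ V, d • v ∈ V}
      mul_mem' := fun {a b} ha hb v hv => by rw [mul_smul]; exact ha _ (hb v hv)
      add_mem' := fun {a b} ha hb v hv => by rw [add_smul]; exact add_mem (ha v hv) (hb v hv)
      algebraMap_mem' := fun c v hv => by
        rw [algebraMap_smul]; exact Submodule.smul_mem _ _ hv }
  have hle : truncatedDiffOp K n p (fun _ => k)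
      ≤ S.map (diffOp K (MvPolynomial (Fin n) K)).val := by
    refine Algebra.adjoin_le ?_
    rintro _ (⟨i, rfl⟩ | ⟨i, j, hj, rfl⟩)
    · exact ⟨mon K _, hX i, rfl⟩
    · refine ⟨dp K p _, hdp _ fun x => ?_, rfl⟩
      rw [Finsupp.single_apply]
      split_ifs
      · exact hj
      · exact pow_pos (Fact.out : p.Prime).pos k
  choose d hd hd' using fun a b : BoxIndex p (fun _ : Fin n => k) =>
    hle (matrixUnit_mem (K := K) a b)
  have hmul : ∀ a b c e, d a b * d c e = if b = c then d a e else 0 := by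
    intro a b c e
    refine Subtype.ext ?_
    have h1 := matrixUnit_mul (K := K) a b c e
    rw [← hd', ← hd'] at h1
    refine h1.trans ?_
    split_ifs
    · exact (hd' _ _).symm
    · rfl
  have hone : ∑ a, d a a = 1 := by
    refine Subtype.ext ?_
    rw [AddSubmonoidClass.coe_finsetSum]
    exact (Finset.sum_congr rfl fun a _ => hd' a a).trans sum_matrixUnit
  have h := card_dvd_finrank_of_matrixUnits (K := K) (V := V)
    (fun a b => (Algebra.lsmul K K M (d a b)).restrict (hd a b))
    (fun a b c e => by
      refine LinearMap.ext fun v => Subtype.ext ?_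
      change d a b • d c e • (v : M) = _
      rw [smul_smul, hmul]
      split_ifs
      · rfl
      · exact zero_smul _ _)
    (by
      refine LinearMap.ext fun v => Subtype.ext ?_
      rw [LinearMap.sum_apply, Submodule.coe_sum]
      change ∑ a, d a a • (v : M) = v
      rw [← Finset.sum_smul, hone, one_smul])
  simpa using h

end Holonomic

/-! ## The multiplicity of holonomic modules -/

section HolonomicMultiplicity

variable {K : Type*} [Field K] {n : ℕ} {p : ℕ} [Fact p.Prime] [CharP K p]
  {M : Type*} [AddCommGroup M] [Module K M]
  [Module (PolyDiffOp K n) M] [IsScalarTower K (PolyDiffOp K n) M]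

variable (n p) in
/-- The subspace of `M` spanned by the `x^α ∂^[β] M₀` with `β_i < q` and `|α| + |β| ≤ j`. -/
noncomputable abbrev boxFiltration (q : ℕ) (M₀ : Submodule K M) (j : ℕ) : Submodule K M :=
  subspaceSMul (opSpan K p (expBox n q) j) M₀

omit [IsScalarTower K (PolyDiffOp K n) M] in
theorem boxFiltration_mono (q : ℕ) (M₀ : Submodule K M) : Monotone (boxFiltration n p q M₀) :=
  fun _ _ h => subspaceSMul_mono (opSpan_mono subset_rfl h) le_rfl

theorem mon_smul_mem_boxFiltration {q j : ℕ} {M₀ : Submodule K M} {v : M}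
    (hv : v ∈ boxFiltration n p q M₀ j) (i : Fin n) :
    mon K (Finsupp.single i 1 : Fin n →₀ ℕ) • v ∈ boxFiltration n p q M₀ (j + 1) := by
  have hcomm : SMulCommClass (PolyDiffOp K n) K M := IsScalarTower.to_smulCommClass'
  have h : boxFiltration n p q M₀ j ≤ (boxFiltration n p q M₀ (j + 1)).comap
      (Algebra.lsmul K K M (mon K (Finsupp.single i 1 : Fin n →₀ ℕ))) := by
    refine subspaceSMul_le.2 fun b hb y hy => ?_
    change mon K (Finsupp.single i 1 : Fin n →₀ ℕ) • b • y ∈ subspaceSMul _ M₀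
    rw [smul_smul]
    refine smul_mem_subspaceSMul ?_ hy
    have := mon_mul_mem hb (Finsupp.single i 1)
    rwa [Finsupp.degree_single, add_comm] at this
  exact h hv

theorem dp_mul_mem_opSpan_expBox {k j : ℕ} {d : PolyDiffOp K n}
    (hd : d ∈ opSpan K p (expBox n (p ^ k)) j) {r : Fin n →₀ ℕ} (hr : r ∈ expBox n (p ^ k)) :
    dp K p r * d ∈ opSpan K p (expBox n (p ^ k)) (j + r.degree) := by
  rw [opSpan_eq_span_dp_mul_mon (isLowerSet_expBox _)] at hd
  induction hd using Submodule.span_induction with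
  | mem x hx =>
    obtain ⟨α, s, hs, hle, rfl⟩ := hx
    rw [← mul_assoc, dp_mul_dp, smul_mul_assoc]
    by_cases hrs : r + s ∈ expBox n (p ^ k)
    · exact Submodule.smul_mem _ _ (dp_mul_mon_mem (isLowerSet_expBox _) rfl hrs
        (by rw [map_add]; omega))
    -- Outside the box some coordinate carries, and the structure constant vanishes.
    · obtain ⟨i, hi⟩ : ∃ i, p ^ k ≤ r i + s i := by
        simpa [expBox] using hrs
      rw [Finset.prod_eq_zero (Finset.mem_univ i)
        (cast_choose_eq_zero_of_overflow p k (hr i) (hs i) hi), zero_smul]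
      exact zero_mem _
  | zero => rw [mul_zero]; exact zero_mem _
  | add x y _ _ hx hy => rw [mul_add]; exact add_mem hx hy
  | smul c x _ hx => rw [mul_smul_comm]; exact Submodule.smul_mem _ _ hx

theorem dp_smul_mem_boxFiltration {k j : ℕ} {M₀ : Submodule K M} {v : M}
    (hv : v ∈ boxFiltration n p (p ^ k) M₀ j) {r : Fin n →₀ ℕ} (hr : r ∈ expBox n (p ^ k)) :
    dp K p r • v ∈ boxFiltration n p (p ^ k) M₀ (j + r.degree) := by
  have hcomm : SMulCommClass (PolyDiffOp K n) K M := IsScalarTower.to_smulCommClass'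
  have h : boxFiltration n p (p ^ k) M₀ j ≤ (boxFiltration n p (p ^ k) M₀ (j + r.degree)).comap
      (Algebra.lsmul K K M (dp K p r)) := by
    refine subspaceSMul_le.2 fun b hb y hy => ?_
    change dp K p r • b • y ∈ subspaceSMul _ M₀
    rw [smul_smul]
    exact smul_mem_subspaceSMul (dp_mul_mem_opSpan_expBox hb hr) hy
  exact h hv

/-- Since |r| ≤ n q in the box, a generator x^α ∂^[r] of degree above n q contains some x_i. From
that index on, V_{m+1} is V_m plus the x_i V_m, so a single equality stops all growth. -/
theorem boxFiltration_eq_of_stable {q j : ℕ} {M₀ : Submodule K M} (hj : n * q ≤ j)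
    (h : boxFiltration n p q M₀ (j + 1) = boxFiltration n p q M₀ j) {m : ℕ} (hm : j ≤ m) :
    boxFiltration n p q M₀ m = boxFiltration n p q M₀ j := by
  induction m, hm using Nat.le_induction with
  | base => rfl
  | succ m hm ih =>
    refine le_antisymm (subspaceSMul_span_le.2 ?_) (boxFiltration_mono q M₀ (by omega))
    rintro _ ⟨α, r, hr, hle, rfl⟩ x hx
    by_cases hd : α.degree + r.degree ≤ m
    · rw [← ih]
      exact smul_mem_subspaceSMul (mon_mul_dp_mem hr hd) hx
    · have hrd : r.degree ≤ n * q := by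
        rw [Finsupp.degree_eq_sum]
        calc ∑ i, r i ≤ ∑ _i : Fin n, q := Finset.sum_le_sum fun i _ => (hr i).le
          _ = n * q := by simp
      obtain ⟨i, α', rfl, hα'⟩ := exists_single_add (α := α) (m := α.degree - 1) (by omega)
      rw [map_add, Finsupp.degree_single] at hle
      rw [mon_add, mul_assoc, mul_smul, ← h]
      refine mon_smul_mem_boxFiltration ?_ i
      rw [← ih]
      exact smul_mem_subspaceSMul (mon_mul_dp_mem hr (by omega)) hx

theorem pow_dvd_finrank_boxFiltration {k j : ℕ} {M₀ : Submodule K M} [Module.Finite K M₀]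
    (h : ∀ m, j ≤ m → boxFiltration n p (p ^ k) M₀ m = boxFiltration n p (p ^ k) M₀ j) :
    (p ^ k) ^ n ∣ Module.finrank K (boxFiltration n p (p ^ k) M₀ j) := by
  have := finite_subspaceSMul (opSpan K p (expBox n (p ^ k)) j) M₀
  refine pow_dvd_finrank_of_stable k (fun i v hv => ?_) fun r hr v hv => ?_
  · rw [← h (j + 1) (by omega)]
    exact mon_smul_mem_boxFiltration hv i
  · rw [← h (j + r.degree) (by omega)]
    exact dp_smul_mem_boxFiltration hv hr

theorem coeff_mul_geomSeries_pow_mono {F G : ℕ → ℚ} (h : ∀ i, F i ≤ G i) (q m i : ℕ) :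
    PowerSeries.coeff i (PowerSeries.mk F * geomSeries q ^ m)
      ≤ PowerSeries.coeff i (PowerSeries.mk G * geomSeries q ^ m) := by
  rw [← sum_divExpLE, ← sum_divExpLE]
  exact Finset.sum_le_sum fun β _ => h _

theorem cast_finrank_subspaceSMul_opSpan {k : ℕ} {N M₀ : Submodule K M} [Module.Finite K M₀]
    (hfree : IsFreeOn (fun β : DivExp n (p ^ k) => dp K p β.1) N)
    (hN : ∀ t ∈ frobeniusCentralizer K n (p ^ k), ∀ x ∈ M₀, t • x ∈ N) (i : ℕ) :
    (Module.finrank K (subspaceSMul (opSpan K p (Set.univ : Set (Fin n →₀ ℕ)) i) M₀) : ℚ)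
      = PowerSeries.coeff i (PowerSeries.mk
          (fun j => (Module.finrank K (boxFiltration n p (p ^ k) M₀ j) : ℚ))
        * geomSeries (p ^ k) ^ n) := by
  rw [finrank_subspaceSMul_opSpan p k hfree hN i, ← sum_divExpLE]
  push_cast
  rfl

theorem isQuasiPolynomial_natCast_tsub (a : ℕ) :
    IsQuasiPolynomial 1 (fun j => ((j - a : ℕ) : ℚ)) 1 1 := by
  have h := IsQuasiPolynomial.of_eventually (q := 1) (f := fun j => ((j - a : ℕ) : ℚ))
    (Q := X - C (a : ℚ)) one_pos (by
      filter_upwards [eventually_ge_atTop a] with j hj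
      rw [Nat.cast_sub hj]; simp)
  rwa [natDegree_X_sub_C, leadingCoeff_X_sub_C] at h

/-- A bound of degree `n` for the Hilbert function forces the box filtration to become
stationary. -/
theorem exists_boxFiltration_stationary {k : ℕ} {N M₀ : Submodule K M} [Module.Finite K M₀]
    (hfree : IsFreeOn (fun β : DivExp n (p ^ k) => dp K p β.1) N)
    (hN : ∀ t ∈ frobeniusCentralizer K n (p ^ k), ∀ x ∈ M₀, t • x ∈ N)
    {Q : ℚ[X]} (hQ : Q.natDegree ≤ n) (hb : ∀ᶠ i : ℕ in atTop, (Module.finrank K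
      (subspaceSMul (opSpan K p (Set.univ : Set (Fin n →₀ ℕ)) i) M₀) : ℚ) ≤ Q.eval (i : ℚ)) :
    ∃ j, ∀ m, j ≤ m → boxFiltration n p (p ^ k) M₀ m = boxFiltration n p (p ^ k) M₀ j := by
  have hq : 0 < p ^ k := pow_pos (Fact.out : p.Prime).pos k
  by_contra hcon
  push Not at hcon
  -- Past the index n q, where a repetition would be permanent, every step must raise the dimension
  -- by at least one.
  have hgrow : ∀ j, j - n * p ^ k ≤ Module.finrank K (boxFiltration n p (p ^ k) M₀ j) := by
    intro j
    induction j with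
    | zero => simp
    | succ j ih =>
      by_cases hj : n * p ^ k ≤ j
      · have hne : boxFiltration n p (p ^ k) M₀ (j + 1) ≠ boxFiltration n p (p ^ k) M₀ j := by
          intro h
          obtain ⟨m, hm, hm'⟩ := hcon j
          exact hm' (boxFiltration_eq_of_stable hj h hm)
        have hfin := finite_subspaceSMul (opSpan K p (expBox n (p ^ k)) (j + 1)) M₀
        have hlt := Submodule.finrank_lt_finrank_of_lt
          (lt_of_le_of_ne (boxFiltration_mono (n := n) (p := p) (p ^ k) M₀ (Nat.le_add_right j 1)) hne.symm)
        omega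
      · omega
  have hqp := ((isQuasiPolynomial_natCast_tsub (n * p ^ k)).of_one hq)
  -- Linear growth followed by n summations gives degree n + 1, beyond the bound of degree n.
  have h1 := IsQuasiPolynomial.mul_geomSeries_pow
    (F := PowerSeries.mk fun j => ((j - n * p ^ k : ℕ) : ℚ)) hq one_ne_zero
    (by simpa only [PowerSeries.coeff_mk] using hqp) n
  have h2 : ∀ i, ∃ m : ℕ, PowerSeries.coeff i
      ((PowerSeries.mk fun j => ((j - n * p ^ k : ℕ) : ℚ)) * geomSeries (p ^ k) ^ n) = m := by
    intro i
    rw [← sum_divExpLE]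
    exact ⟨_, (Nat.cast_sum _ _).symm⟩
  choose g hg using h2
  simp only [hg] at h1
  refine (h1.isAlmostPolynomial hq).not_le (by positivity) (show n < 1 + n by omega) hQ ?_
  filter_upwards [hb] with i hi
  rw [← hg]
  refine le_trans ?_ hi
  rw [cast_finrank_subspaceSMul_opSpan hfree hN]
  exact coeff_mul_geomSeries_pow_mono (fun j => by exact_mod_cast hgrow j) _ _ _

-- The stationary dimension is q^n e; n summations in steps of q divide it by q^n n!, leaving e /
-- n!. Positivity of e comes from M₀ ≠ 0.
variable (p) in
theorem IsHolonomic.exists_isAlmostPolynomial [Nontrivial M] (h : IsHolonomic K n M)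
    (hM : Module.FinitePresentation (PolyDiffOp K n) M) {M₀ : Submodule K M}
    (h₀ : IsGeneratingSubspace (PolyDiffOp K n) M₀) :
    ∃ e : ℕ, 0 < e ∧ IsAlmostPolynomial (fun i => Module.finrank K
      (subspaceSMul (opSpan K p (Set.univ : Set (Fin n →₀ ℕ)) i) M₀)) n
        ((e : ℚ) / n.factorial) := by
  have hfin : Module.Finite K M₀ := h₀.1
  obtain ⟨Q, hQ, hb⟩ := h.exists_bound p M₀
  obtain ⟨k, N, hfree, hN⟩ := exists_isFreeOn p hM h₀
  have hq : 0 < p ^ k := pow_pos (Fact.out : p.Prime).pos k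
  obtain ⟨j, hj⟩ := exists_boxFiltration_stationary hfree hN hQ hb
  obtain ⟨e, he⟩ := pow_dvd_finrank_boxFiltration hj
  have hfinV := finite_subspaceSMul (opSpan K p (expBox n (p ^ k)) j) M₀
  have hpos : 0 < Module.finrank K (boxFiltration n p (p ^ k) M₀ j) := by
    have hne : M₀ ≠ ⊥ := by
      rintro rfl
      have h1 := h₀.2
      rw [Submodule.bot_coe, Submodule.span_zero_singleton] at h1
      exact bot_ne_top h1
    obtain ⟨x, hx, hx0⟩ := Submodule.exists_mem_ne_zero_of_ne_bot hne
    have h1 : (1 : PolyDiffOp K n) • x ∈ boxFiltration n p (p ^ k) M₀ j :=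
      smul_mem_subspaceSMul (one_mem_opSpan (L := expBox n (p ^ k)) (fun _ => hq) j) hx
    rw [one_smul] at h1
    have : Nontrivial (boxFiltration n p (p ^ k) M₀ j) :=
      ⟨⟨⟨x, h1⟩, 0, fun h => hx0 (congrArg Subtype.val h)⟩⟩
    exact Module.finrank_pos
  have he0 : 0 < e := Nat.pos_of_ne_zero (by rintro rfl; rw [mul_zero] at he; omega)
  have h1 := IsQuasiPolynomial.of_eventually hq
    (f := fun j => (Module.finrank K (boxFiltration n p (p ^ k) M₀ j) : ℚ))
    (Q := C (((p ^ k) ^ n * e : ℕ) : ℚ)) (eventually_atTop.2 ⟨j, fun m hm => by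
      rw [hj m hm, he, eval_C]⟩)
  rw [natDegree_C, leadingCoeff_C] at h1
  have h2 := IsQuasiPolynomial.mul_geomSeries_pow
    (F := PowerSeries.mk fun j => (Module.finrank K (boxFiltration n p (p ^ k) M₀ j) : ℚ)) hq
    (c := (((p ^ k) ^ n * e : ℕ) : ℚ)) (by rw [Nat.cast_ne_zero]; positivity)
    (by simpa only [PowerSeries.coeff_mk] using h1) n
  simp only [← cast_finrank_subspaceSMul_opSpan hfree hN] at h2
  refine ⟨e, he0, ?_⟩
  have h3 := h2.isAlmostPolynomial hq
  convert h3 using 1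
  · rw [zero_add]
  · have : (p : ℚ) ≠ 0 := by exact_mod_cast (Fact.out : p.Prime).ne_zero
    push_cast
    rw [zero_add]
    field_simp
    simp

omit [IsScalarTower K (PolyDiffOp K n) M] in
theorem hasMultiplicity_of_isAlmostPolynomial {M₀ : Submodule K M} {d : ℕ} {c e : ℚ}
    (h : IsAlmostPolynomial (fun i => Module.finrank K
      (subspaceSMul (opSpan K p (Set.univ : Set (Fin n →₀ ℕ)) i) M₀)) d c)
    (he : e = d.factorial * c) : HasMultiplicity K n M₀ d e := by
  have hF : canonicalFiltration K n = opSpan K p Set.univ := funext (canonicalFiltration_eq p)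
  refine ⟨c, ?_, he⟩
  rw [hF]
  exact h

theorem IsHolonomic.hasMultiplicity [Nontrivial M] (h : IsHolonomic K n M) (p : ℕ)
    [Fact p.Prime] [CharP K p]
    (hM : Module.FinitePresentation (PolyDiffOp K n) M) :
    ∃ e : ℕ, 0 < e ∧ ∀ M₀ : Submodule K M, IsGeneratingSubspace (PolyDiffOp K n) M₀ →
      HasMultiplicity K n M₀ n (e : ℚ) := by
  obtain ⟨_, _, M₀, h₀, _⟩ := id h
  obtain ⟨e, he, h1⟩ := h.exists_isAlmostPolynomial p hM h₀
  have hf : (n.factorial : ℚ) ≠ 0 := by positivity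
  have hle : ∀ {M₁ M₂ : Submodule K M}, IsGeneratingSubspace (PolyDiffOp K n) M₁ →
      IsGeneratingSubspace (PolyDiffOp K n) M₂ → ∃ a, ∀ i,
      Module.finrank K (subspaceSMul (opSpan K p (Set.univ : Set (Fin n →₀ ℕ)) i) M₁)
      ≤ Module.finrank K (subspaceSMul (opSpan K p (Set.univ : Set (Fin n →₀ ℕ)) (i + a)) M₂) := by
    intro M₁ M₂ h₁ h₂
    obtain ⟨a, ha⟩ := exists_le_subspaceSMul p h₂ (Module.Finite.iff_fg.1 h₁.1)
    have := h₂.1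
    refine ⟨a, fun i => ?_⟩
    have := finite_subspaceSMul (opSpan K p (Set.univ : Set (Fin n →₀ ℕ)) (i + a)) M₂
    exact Submodule.finrank_mono
      ((subspaceSMul_mono le_rfl ha).trans subspaceSMul_opSpan_subspaceSMul_le)
  refine ⟨e, he, fun M₁ h₁ => ?_⟩
  obtain ⟨e', he', h2⟩ := h.exists_isAlmostPolynomial p hM h₁
  obtain ⟨a, ha⟩ := hle h₀ h₁
  obtain ⟨b, hb⟩ := hle h₁ h₀
  have hne : (e : ℚ) / n.factorial ≠ 0 := by positivity
  have hne' : (e' : ℚ) / n.factorial ≠ 0 := by positivity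
  have heq := le_antisymm (h1.leadingCoeff_le hne hne' h2 ha) (h2.leadingCoeff_le hne' hne h1 hb)
  exact hasMultiplicity_of_isAlmostPolynomial (heq ▸ h2) (by field_simp)

end HolonomicMultiplicity

/-! ## Finitely presented modules of small multiplicity -/

section SmallMultiplicity

variable (K : Type*) [Field K] (n p : ℕ) [Fact p.Prime] [CharP K p] (k m : ℕ)

/-- The operators `∂_i^[r]`, `0 < r < q`, and `x_j^q`, `j ≥ m`, where `q = p ^ k`. -/
def smallRelations : Set (PolyDiffOp K n) :=
  {d | ∃ i r, 0 < r ∧ r < p ^ k ∧ d = dp K p (Finsupp.single i r)} ∪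
    {d | ∃ j : Fin n, m ≤ j ∧ d = mon K (Finsupp.single j (p ^ k))}

theorem finite_smallRelations : (smallRelations K n p k m).Finite := by
  refine Set.Finite.union ?_ ?_
  · refine (Set.finite_range fun x : Fin n × Fin (p ^ k) =>
      dp K p (Finsupp.single x.1 (x.2 : ℕ))).subset ?_
    rintro _ ⟨i, r, -, hr, rfl⟩
    exact ⟨(i, ⟨r, hr⟩), rfl⟩
  · refine (Set.finite_range fun j : Fin n => mon K (Finsupp.single j (p ^ k))).subset ?_
    rintro _ ⟨j, -, rfl⟩
    exact ⟨j, rfl⟩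

/-- The left ideal generated by `smallRelations`. -/
noncomputable def smallIdeal : Submodule (PolyDiffOp K n) (PolyDiffOp K n) :=
  Submodule.span (PolyDiffOp K n) (smallRelations K n p k m)

/-- The ideal of `P_n` generated by the `x_j^q`, `j ≥ m`. -/
noncomputable def powIdeal : Ideal (MvPolynomial (Fin n) K) :=
  Ideal.span ((fun s => MvPolynomial.monomial s (1 : K)) ''
    {s | ∃ j : Fin n, m ≤ j ∧ s = Finsupp.single j (p ^ k)})

/-- The elements of the centralizer of the `x_i^q` that send `1` into `powIdeal`. -/
noncomputable def smallStable : Submodule K (PolyDiffOp K n) :=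
  Subalgebra.toSubmodule (frobeniusCentralizer K n (p ^ k)) ⊓
    ((powIdeal K n p k m).restrictScalars K).comap
      ((LinearMap.applyₗ (1 : MvPolynomial (Fin n) K)) ∘ₗ
        (diffOp K (MvPolynomial (Fin n) K)).val.toLinearMap)

variable {K n p k m}

omit [Fact p.Prime] [CharP K p] in
theorem mem_smallStable {d : PolyDiffOp K n} : d ∈ smallStable K n p k m ↔
    d ∈ frobeniusCentralizer K n (p ^ k) ∧ d.1 1 ∈ powIdeal K n p k m := Iff.rfl

omit [Fact p.Prime] [CharP K p] in
theorem apply_mem_powIdeal {t : PolyDiffOp K n} (ht : t ∈ frobeniusCentralizer K n (p ^ k))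
    {u : MvPolynomial (Fin n) K} (hu : u ∈ powIdeal K n p k m) : t.1 u ∈ powIdeal K n p k m := by
  -- t is linear over the x_j^q but not over P_n; quantifying over all multiples a u makes the
  -- induction over the ideal go through.
  have key : ∀ a, t.1 (a * u) ∈ powIdeal K n p k m := by
    induction hu using Submodule.span_induction with
    | mem x hx =>
      obtain ⟨_, ⟨j, hj, rfl⟩, rfl⟩ := hx
      intro a
      have h1 := (Subalgebra.mem_centralizer_iff K).1 ht _ ⟨j, rfl⟩
      have h2 : MvPolynomial.monomial (Finsupp.single j (p ^ k)) (1 : K) * t.1 a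
          = t.1 (MvPolynomial.monomial (Finsupp.single j (p ^ k)) (1 : K) * a) :=
        LinearMap.congr_fun (congrArg Subtype.val h1) a
      rw [mul_comm, ← h2]
      exact Ideal.mul_mem_right _ _ (Ideal.subset_span ⟨_, ⟨j, hj, rfl⟩, rfl⟩)
    | zero => intro a; rw [mul_zero, map_zero]; exact zero_mem _
    | add x y _ _ hx hy => intro a; rw [mul_add, map_add]; exact add_mem (hx a) (hy a)
    | smul b x _ hx => intro a; rw [smul_eq_mul, ← mul_assoc]; exact hx _
  simpa using key 1

theorem smallRelations_subset : smallRelations K n p k m ⊆ smallStable K n p k m := by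
  rintro _ (⟨i, r, hr0, hr, rfl⟩ | ⟨j, hj, rfl⟩)
  · refine mem_smallStable.2 ⟨dp_mem_frobeniusCentralizer p k fun x => ?_, ?_⟩
    · rw [Finsupp.single_apply]
      split_ifs
      · exact hr
      · exact pow_pos (Fact.out : p.Prime).pos k
    · have h : dividedPartial K (Finsupp.single i r) (MvPolynomial.monomial 0 (1 : K)) = 0 := by
        rw [dividedPartial_monomial, prod_choose_eq_zero, mul_zero, map_zero]
        rw [Finsupp.single_le_iff]
        simpa using hr0.ne'
      change dividedPartial K (Finsupp.single i r) 1 ∈ _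
      rw [show (1 : MvPolynomial (Fin n) K) = MvPolynomial.monomial 0 1 from rfl, h]
      exact zero_mem _
  · refine mem_smallStable.2 ⟨mon_mem_frobeniusCentralizer _ _, ?_⟩
    change MvPolynomial.monomial _ (1 : K) * 1 ∈ _
    rw [mul_one]
    exact Ideal.subset_span ⟨_, ⟨j, hj, rfl⟩, rfl⟩

/-- `smallStable` is stable under the centralizer and contains the relations, so freeness confines
the centralizer part of the left ideal to it. This upper bound on the ideal yields linear
independence below. -/
theorem mem_smallStable_of_mem_smallIdeal {z : PolyDiffOp K n} (hz : z ∈ smallIdeal K n p k m)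
    (hzT : z ∈ frobeniusCentralizer K n (p ^ k)) : z ∈ smallStable K n p k m :=
  (isFreeOn_dp K p k).mem_of_mem_span (mem_closure_dp_mul p k) (i₀ := ⟨0, fun _ => dvd_zero _⟩)
    (dp_zero p) (fun _ ht _ hy => mem_smallStable.2
      ⟨(frobeniusCentralizer K n (p ^ k)).mul_mem ht (mem_smallStable.1 hy).1,
        apply_mem_powIdeal ht (mem_smallStable.1 hy).2⟩)
    inf_le_left smallRelations_subset hz hzT

variable (K n p k m) in
/-- The cyclic module `𝒟(P_n) / smallIdeal`. -/
abbrev SmallModule : Type _ := PolyDiffOp K n ⧸ smallIdeal K n p k m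

variable (K n p k m) in
/-- The line spanned by the generator of `SmallModule`. -/
noncomputable def smallGenerator : Submodule K (SmallModule K n p k m) :=
  Submodule.span K {(smallIdeal K n p k m).mkQ 1}

theorem smul_mkQ_one (d : PolyDiffOp K n) :
    d • (smallIdeal K n p k m).mkQ 1 = (smallIdeal K n p k m).mkQ d := by
  rw [← map_smul, smul_eq_mul, mul_one]

theorem smul_mem_of_mem_smallGenerator {x : SmallModule K n p k m}
    (hx : x ∈ smallGenerator K n p k m) {W : Submodule K (SmallModule K n p k m)}
    {d : PolyDiffOp K n} (h : (smallIdeal K n p k m).mkQ d ∈ W) : d • x ∈ W := by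
  obtain ⟨c, rfl⟩ := Submodule.mem_span_singleton.1 hx
  have hcomm : SMulCommClass (PolyDiffOp K n) K (SmallModule K n p k m) :=
    IsScalarTower.to_smulCommClass'
  rw [smul_comm, smul_mkQ_one]
  exact Submodule.smul_mem _ _ h

theorem finitePresentation_smallModule :
    Module.FinitePresentation (PolyDiffOp K n) (SmallModule K n p k m) := by
  refine Module.finitePresentation_of_surjective _ (Submodule.mkQ_surjective _) ?_
  rw [Submodule.ker_mkQ]
  exact Submodule.fg_span (finite_smallRelations K n p k m)

instance : Module.Finite K (smallGenerator K n p k m) :=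
  Module.Finite.span_singleton K _

theorem isGeneratingSubspace_smallGenerator :
    IsGeneratingSubspace (PolyDiffOp K n) (smallGenerator K n p k m) := by
  refine ⟨inferInstance, eq_top_iff.2 fun x _ => ?_⟩
  obtain ⟨d, rfl⟩ := Submodule.mkQ_surjective _ x
  rw [← smul_mkQ_one]
  exact Submodule.smul_mem _ _ (Submodule.subset_span (Submodule.mem_span_singleton_self _))

theorem isFreeOn_smallModule : IsFreeOn (fun β : DivExp n (p ^ k) => dp K p β.1)
    ((Subalgebra.toSubmodule (frobeniusCentralizer K n (p ^ k))).map
      ((smallIdeal K n p k m).mkQ.restrictScalars K)) :=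
  IsFreeOn.of_surjective (mem_closure_dp_mul p k) (isFreeOn_dp K p k)
    (fun _ ht _ hy => (frobeniusCentralizer K n (p ^ k)).mul_mem ht hy) _
    (smallRelations_subset.trans inf_le_left) (Submodule.ker_mkQ _)

theorem dp_mem_smallIdeal {r : Fin n →₀ ℕ} (hr : r ∈ expBox n (p ^ k)) (h0 : r ≠ 0) :
    dp K p r ∈ smallIdeal K n p k m := by
  obtain ⟨i, hi⟩ := Finsupp.ne_iff.1 h0
  have hle : Finsupp.single i (r i) ≤ r := by rw [Finsupp.single_le_iff]
  have h := dp_mul_dp (K := K) p (r - Finsupp.single i (r i)) (Finsupp.single i (r i))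
  have h1 : ∏ j, (((r - Finsupp.single i (r i)) j + Finsupp.single i (r i) j).choose
      ((r - Finsupp.single i (r i)) j) : K) = 1 := by
    refine Finset.prod_eq_one fun j _ => ?_
    by_cases hj : j = i
    · subst hj; simp
    · simp [Finsupp.single_eq_of_ne hj]
  rw [h1, one_smul, tsub_add_cancel_of_le hle] at h
  rw [← h, ← smul_eq_mul]
  refine Submodule.smul_mem _ _ (Submodule.subset_span (Or.inl ⟨i, r i, ?_, hr i, rfl⟩))
  simpa [Nat.pos_iff_ne_zero] using hi

theorem mon_mem_smallIdeal {α : Fin n →₀ ℕ} {j : Fin n} (hj : m ≤ j) (h : p ^ k ≤ α j) :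
    mon K α ∈ smallIdeal K n p k m := by
  rw [← tsub_add_cancel_of_le (Finsupp.single_le_iff.2 h), mon_add, ← smul_eq_mul]
  exact Submodule.smul_mem _ _ (Submodule.subset_span (Or.inr ⟨j, hj, rfl⟩))

variable (n p k m) in
/-- The exponents of degree at most `j` whose coordinates with index at least `m` are less than
`q`. -/
noncomputable def smallExp (j : ℕ) : Finset (Fin n →₀ ℕ) := by
  classical
  exact (Finsupp.finite_of_degree_le (σ := Fin n) j).toFinset.filter
    fun γ => ∀ x : Fin n, m ≤ x → γ x < p ^ k

omit [Fact p.Prime] in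
theorem mem_smallExp {j : ℕ} {γ : Fin n →₀ ℕ} :
    γ ∈ smallExp n p k m j ↔ γ.degree ≤ j ∧ ∀ x : Fin n, m ≤ x → γ x < p ^ k := by
  simp [smallExp]

/-- In the quotient every ∂^[r] with r ≠ 0 in the box kills the generator, and so does every
monomial divisible by a relation x_j^q; only the truncated monomials survive. -/
theorem boxFiltration_smallGenerator (j : ℕ) :
    boxFiltration n p (p ^ k) (smallGenerator K n p k m) j
      = Submodule.span K (Set.range fun α : smallExp n p k m j =>
          (smallIdeal K n p k m).mkQ (mon K α.1)) := by
  have hq : 0 < p ^ k := pow_pos (Fact.out : p.Prime).pos k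
  apply le_antisymm
  · refine subspaceSMul_span_le.2 ?_
    rintro _ ⟨α, r, hr, hle, rfl⟩ x hx
    refine smul_mem_of_mem_smallGenerator hx ?_
    have hzero : ∀ d ∈ smallIdeal K n p k m, (smallIdeal K n p k m).mkQ d = 0 := fun d hd =>
      (Submodule.Quotient.mk_eq_zero _).2 hd
    by_cases hr0 : r = 0
    · subst hr0
      rw [dp_zero, mul_one]
      by_cases hα : ∀ x : Fin n, m ≤ x → α x < p ^ k
      · rw [map_zero, add_zero] at hle
        exact Submodule.subset_span ⟨⟨α, mem_smallExp.2 ⟨hle, hα⟩⟩, rfl⟩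
      · push Not at hα
        obtain ⟨x, hx, hx'⟩ := hα
        rw [hzero _ (mon_mem_smallIdeal hx hx')]
        exact zero_mem _
    · have h1 : mon K α * dp K p r ∈ smallIdeal K n p k m :=
        Submodule.smul_mem _ (mon K α) (dp_mem_smallIdeal hr hr0)
      rw [hzero _ h1]
      exact zero_mem _
  · refine Submodule.span_le.2 ?_
    rintro _ ⟨α, rfl⟩
    change (smallIdeal K n p k m).mkQ (mon K α.1) ∈ boxFiltration n p (p ^ k) _ j
    have h1 : mon K α.1 = mon K α.1 * dp K p 0 := by rw [dp_zero, mul_one]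
    rw [← smul_mkQ_one, h1]
    refine smul_mem_subspaceSMul (mon_mul_dp_mem (L := expBox n (p ^ k)) (fun _ => hq) ?_)
      (Submodule.mem_span_singleton_self _)
    rw [map_zero, add_zero]
    exact (mem_smallExp.1 α.2).1

/-- A combination of these monomials in the left ideal, applied to the polynomial 1, falls into the
monomial ideal of the x_j^q; but none of its monomials is divisible by such a power. -/
theorem linearIndependent_smallExp (j : ℕ) :
    LinearIndependent K fun α : smallExp n p k m j => (smallIdeal K n p k m).mkQ (mon K α.1) := by
  classical
  refine Fintype.linearIndependent_iff.2 fun g hg α => ?_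
  set z : PolyDiffOp K n := ∑ β : smallExp n p k m j, g β • mon K β.1 with hz
  have hzI : z ∈ smallIdeal K n p k m := by
    rw [← Submodule.Quotient.mk_eq_zero, ← hg]
    change (smallIdeal K n p k m).mkQ.restrictScalars K z = _
    rw [hz, map_sum]
    exact Finset.sum_congr rfl fun β _ => map_smul _ _ _
  have hzT : z ∈ frobeniusCentralizer K n (p ^ k) :=
    Subalgebra.sum_mem _ fun β _ => Subalgebra.smul_mem _ (mon_mem_frobeniusCentralizer _ _) _
  have h1 := (mem_smallStable.1 (mem_smallStable_of_mem_smallIdeal hzI hzT)).2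
  have h2 : z.1 1 = ∑ β : smallExp n p k m j, MvPolynomial.monomial β.1 (g β) := by
    rw [hz, AddSubmonoidClass.coe_finsetSum, LinearMap.sum_apply]
    refine Finset.sum_congr rfl fun β _ => ?_
    change g β • (MvPolynomial.monomial β.1 (1 : K) * 1) = _
    rw [mul_one, MvPolynomial.smul_monomial, smul_eq_mul, mul_one]
  have h3 : (z.1 1).coeff α.1 = g α := by
    rw [h2, MvPolynomial.coeff_sum, Finset.sum_eq_single α]
    · rw [MvPolynomial.coeff_monomial, if_pos rfl]
    · intro β _ hβ
      rw [MvPolynomial.coeff_monomial, if_neg fun h => hβ (Subtype.ext h)]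
    · simp
  by_contra hne
  obtain ⟨_, ⟨x, hx, rfl⟩, hle⟩ := MvPolynomial.mem_ideal_span_monomial_image.1 h1 α.1
    (MvPolynomial.mem_support_iff.2 (h3.trans_ne hne))
  have := (mem_smallExp.1 α.2).2 x hx
  rw [Finsupp.single_le_iff] at hle
  omega

theorem finrank_boxFiltration_smallGenerator (j : ℕ) :
    Module.finrank K (boxFiltration n p (p ^ k) (smallGenerator K n p k m) j)
      = (smallExp n p k m j).card := by
  rw [boxFiltration_smallGenerator, finrank_span_eq_card (linearIndependent_smallExp j),
    Fintype.card_coe]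

-- Each of the n - m truncated variables contributes (1 - t^q)/(1 - t), and one factor 1/(1 - t^q)
-- turns it into 1/(1 - t). For each of the m free variables the factor 1/(1 - t^q) remains.
omit [CharP K p] in
theorem mk_card_smallExp (hm : m ≤ n) : (PowerSeries.mk fun j => ((smallExp n p k m j).card : ℚ))
    * geomSeries (p ^ k) ^ n = geomSeries 1 * geomSeries 1 ^ n * geomSeries (p ^ k) ^ m := by
  classical
  have hq : 0 < p ^ k := pow_pos (Fact.out : p.Prime).pos k
  have hone : geomSeries 1 = PowerSeries.mk fun _ => (1 : ℚ) := by
    ext i; simp [geomSeries]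
  have h1 : (PowerSeries.mk fun j => ((smallExp n p k m j).card : ℚ))
      = geomSeries 1 * ∏ x : Fin n, PowerSeries.mk fun j =>
        if (m ≤ x → j < p ^ k) then (1 : ℚ) else 0 := by
    ext j
    rw [hone, coeff_mul_prod_indicator (fun _ => 1) (fun (x : Fin n) j => m ≤ x → j < p ^ k) j,
      PowerSeries.coeff_mk, smallExp, Finset.sum_const, nsmul_eq_mul, mul_one]
  have h2 : ∀ x : Fin n, (PowerSeries.mk fun j => if (m ≤ x → j < p ^ k) then (1 : ℚ) else 0)
      * geomSeries (p ^ k) = geomSeries 1 * if (x : ℕ) < m then geomSeries (p ^ k) else 1 := by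
    intro x
    split_ifs with hx
    · congr 1
      rw [hone]
      ext j
      simp only [PowerSeries.coeff_mk]
      rw [if_pos fun h => absurd h (by omega)]
    · rw [mul_one, ← truncGeomSeries_mul hq]
      congr 1
      ext j
      have : m ≤ (x : ℕ) := by omega
      simp [truncGeomSeries, this]
  have h3 : ∏ x : Fin n, (if (x : ℕ) < m then geomSeries (p ^ k) else 1)
      = geomSeries (p ^ k) ^ m := by
    rw [Finset.prod_ite, Finset.prod_const, Finset.prod_const_one, mul_one]
    congr 1
    rw [Fin.card_filter_val_lt, min_eq_right hm]
  have h4 : geomSeries (p ^ k) ^ n = ∏ _x : Fin n, geomSeries (p ^ k) := by simp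
  rw [h1, mul_assoc, h4, ← Finset.prod_mul_distrib, Finset.prod_congr rfl fun x _ => h2 x,
    Finset.prod_mul_distrib, h3]
  simp [mul_assoc]

/-- The factors 1/(1 - t)^(n+1) give degree n with leading coefficient 1/n!; the m summations in
steps of q then raise the degree to n + m and divide by q^m. -/
theorem isAlmostPolynomial_smallModule (hm : m ≤ n) :
    IsAlmostPolynomial (fun i => Module.finrank K (subspaceSMul
      (opSpan K p (Set.univ : Set (Fin n →₀ ℕ)) i) (smallGenerator K n p k m)))
      (n + m) (1 / ((p ^ k : ℕ) ^ m * (n + m).factorial)) := by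
  have hq : 0 < p ^ k := pow_pos (Fact.out : p.Prime).pos k
  have h1 := isQuasiPolynomial_geomSeries_one.mul_geomSeries_pow one_pos one_ne_zero n
  have h2 := (h1.of_one hq).mul_geomSeries_pow hq (by positivity) m
  simp only [← mk_card_smallExp hm, ← finrank_boxFiltration_smallGenerator (K := K)] at h2
  have h3 := fun i => cast_finrank_subspaceSMul_opSpan (isFreeOn_smallModule (K := K) (m := m))
    (M₀ := smallGenerator K n p k m) (fun t ht x hx => smul_mem_of_mem_smallGenerator hx
      ⟨t, ht, rfl⟩) i
  simp only [← h3] at h2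
  have h4 := h2.isAlmostPolynomial hq
  convert h4 using 1
  · rw [zero_add]
  · have : (p : ℚ) ≠ 0 := by exact_mod_cast (Fact.out : p.Prime).ne_zero
    rw [zero_add]
    push_cast
    field_simp
    simp

theorem not_isHolonomic_smallModule (hm : m ≤ n) (hm0 : 0 < m) :
    ¬ IsHolonomic K n (SmallModule K n p k m) := by
  intro h
  obtain ⟨Q, hQ, hb⟩ := h.exists_bound p (smallGenerator K n p k m)
  have hq : 0 < p ^ k := pow_pos (Fact.out : p.Prime).pos k
  exact (isAlmostPolynomial_smallModule hm).not_le (by positivity) (by omega) hQ hb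

theorem hasMultiplicity_smallModule (hm : m ≤ n) :
    HasMultiplicity K n (smallGenerator K n p k m) (n + m) (1 / ((p ^ k : ℕ) : ℚ) ^ m) := by
  have : ((p ^ k : ℕ) : ℚ) ≠ 0 := by
    exact_mod_cast pow_ne_zero k (Fact.out : p.Prime).ne_zero
  exact hasMultiplicity_of_isAlmostPolynomial (isAlmostPolynomial_smallModule hm)
    (by field_simp)

end SmallMultiplicity

/-! ### Assembly of the three statements -/

theorem mainTheorem8 (p : ℕ) [Fact p.Prime] (K : Type u) [Field K] [CharP K p] (n : ℕ) :
    -- the multiplicity of a nonzero holonomic finitely presented module is a natural number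
    (∀ (M : Type v) [AddCommGroup M] [Module K M] [Module (PolyDiffOp K n) M]
        [IsScalarTower K (PolyDiffOp K n) M] [Nontrivial M],
        Module.FinitePresentation (PolyDiffOp K n) M → IsHolonomic K n M →
        ∃ e : ℕ, 0 < e ∧ ∀ M₀ : Submodule K M, IsGeneratingSubspace (PolyDiffOp K n) M₀ →
          HasMultiplicity K n M₀ n (e : ℚ)) ∧
    -- non-holonomic finitely presented modules can have arbitrarily small multiplicity
    (∀ d : ℕ, n < d → d ≤ 2 * n → ∀ ε : ℚ, 0 < ε →
        ∃ (M : Type u) (_ : AddCommGroup M) (_ : Module K M) (_ : Module (PolyDiffOp K n) M)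
          (_ : IsScalarTower K (PolyDiffOp K n) M),
          Module.FinitePresentation (PolyDiffOp K n) M ∧ ¬ IsHolonomic K n M ∧
          ∃ (M₀ : Submodule K M) (e : ℚ), IsGeneratingSubspace (PolyDiffOp K n) M₀ ∧
            HasMultiplicity K n M₀ d e ∧ 0 < e ∧ e < ε) ∧
    -- divisibility of the dimensions of finite dimensional modules over the subalgebras `T_k`
    (∀ (k : Fin n → ℕ) (M' : Type w) [AddCommGroup M'] [Module K M']
        [Module (truncatedDiffOp K n p k) M'] [IsScalarTower K (truncatedDiffOp K n p k) M']
        [FiniteDimensional K M'],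
        p ^ (∑ i, k i) ∣ Module.finrank K M') := by
  refine ⟨fun M _ _ _ _ _ hM h => h.hasMultiplicity p hM, fun d hd hd' ε hε => ?_,
    fun k M' _ _ _ _ _ => pow_dvd_finrank_of_module M'⟩
  -- This gives d = n + m + 1, so the number of free variables is m + 1; it is positive, whence
  -- q^(-(m+1)) ≤ q^(-1) < ε for k large.
  obtain ⟨m, rfl⟩ := Nat.exists_eq_add_of_lt hd
  have hp : (1 : ℚ) < p := by exact_mod_cast (Fact.out : p.Prime).one_lt
  obtain ⟨k, hk⟩ := exists_pow_lt_of_lt_one hε (inv_lt_one_of_one_lt₀ hp)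
  have hq : (1 : ℚ) ≤ (p : ℚ) ^ k := one_le_pow₀ hp.le
  refine ⟨SmallModule K n p k (m + 1), inferInstance, inferInstance, inferInstance, inferInstance,
    finitePresentation_smallModule, not_isHolonomic_smallModule (by omega) (by omega),
    smallGenerator K n p k (m + 1), _, isGeneratingSubspace_smallGenerator,
    hasMultiplicity_smallModule (by omega), ?_, ?_⟩
  · have : 0 < p ^ k := pow_pos (Fact.out : p.Prime).pos k
    positivity
  · refine lt_of_le_of_lt ?_ hk
    push_cast
    rw [inv_pow, ← one_div]
    exact one_div_le_one_div_of_le (by positivity) (le_self_pow₀ hq (by omega))
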